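/- Let $n\ge 2$, let $C^*(F_{n-1})$ be the full group C$^*$-algebra of the free group on $n-1$ generators, and let $u_1,\dots,u_{n-1}\in C^*(F_{n-1})$ be universal unitaries that generate it (i.e. unitaries generating $C^*(F_{n-1})$ such that for all unitaries $v_1,\dots,v_{n-1}$ in a unital C$^*$-algebra $B$ there is a unital $*$-homomorphism $C^*(F_{n-1})\to B$ with $u_j\mapsto v_j$). Let $S_{n-1}=\mathrm{Span}\{1,u_j,u_j^*:1\le j\le n-1\}\subseteq C^*(F_{n-1})$, let $T_n\subseteq M_n(\mathbb C)$ be the operator system of tridiagonal matrices ($A_{ij}=0$ for $|i-j|\ge 2$), and let $J_n\subseteq T_n$ be the space of diagonal matrices of trace $0$. Let $\phi:T_n\to S_{n-1}$ be the linear map with $$\phi(E_{ii})=\tfrac1n 1\ (1\le i\le n),\qquad \phi(E_{i,i+1})=\tfrac1n u_i,\quad \phi(E_{i+1,i})=\tfrac1n u_i^*\ (1\le i\le n-1).$$ For an operator system $S$ with unit $1$ and a kernel $J\subseteq S$ (i.e. the kernel of a completely positive map from $S$ into some operator system), let $q:S\to S/J$ be the canonical map, applied entrywise to matrices, and for $p\in\mathbb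 N$ let $$D_p(S/J)=\{q(H): H\in M_p(S)_{\rm sa},\ \exists K\in M_p(J)_{\rm sa},\ H+K\in M_p(S)_+\},$$ $$C_p(S/J)=\{q(H): H\in M_p(S)_{\rm sa},\ \forall\varepsilon>0\ \exists K_\varepsilon\in M_p(J)_{\rm sa},\ \varepsilon 1+H+K_\varepsilon\in M_p(S)_+\}.$$ The quotient operator system is $S/J$ with the positive cones $C_p(S/J)$ and order unit $q(1)$. The kernel $J$ is completely order proximinal if $D_p(S/J)=C_p(S/J)$ for all $p$. A completely positive linear map $\psi:S\to T$ is a complete quotient map if the induced linear map $\dot\psi:S/\ker\psi\to T$ is a complete order isomorphism, that is, a linear bijection that is completely positive together with its inverse. Then: 1. $\ker\phi=J_n$; 2. $J_n\subseteq T_n$ is a completely order proximinal kernel; 3. $\phi$ is a complete quotient map. In particular $T_n/J_n\cong S_{n-1}$ through a complete order isomorphism sending $q(X)$ to $\phi(X)$ for all $X\in T_n$. -/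

import Mathlib

noncomputable section
open scoped ComplexConjugate

universe u v

namespace OpSys

/-- The adjoint `[x_{ij}]^* = [x_{ji}^*]` of a matrix over a space with involution. -/
def matAdj {V : Type*} [AddCommGroup V] [Module ℂ V] (s : V →ₗ⋆[ℂ] V) {p : ℕ}
    (X : Matrix (Fin p) (Fin p) V) : Matrix (Fin p) (Fin p) V :=
  Matrix.of fun i j => s (X j i)

/-- The matrix `a^* X a`, for a scalar matrix `a` and a matrix `X` over `V`. -/
def compress {V : Type*} [AddCommGroup V] [Module ℂ V] {p q : ℕ}
    (a : Matrix (Fin p) (Fin q) ℂ) (X : Matrix (Fin p) (Fin p) V) : Matrix (Fin q) (Fin q) V :=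
  Matrix.of fun k l => ∑ i, ∑ j, (conj (a i k) * a j l) • X i j

/-- The matrix `e ⊗ 1_p`. -/
def diagUnit {V : Type*} [AddCommGroup V] (e : V) (p : ℕ) : Matrix (Fin p) (Fin p) V :=
  Matrix.diagonal fun _ => e

end OpSys

open OpSys

/-- An (abstract) operator system structure on a complex vector space `V`: an involution, a
matrix ordering by proper cones of selfadjoint matrices, and an Archimedean matrix order unit. -/
structure OperatorSystem (V : Type u) [AddCommGroup V] [Module ℂ V] where
  /-- the involution -/
  adj : V →ₗ⋆[ℂ] V
  adj_adj : ∀ x, adj (adj x) = x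
  /-- the order unit -/
  unit : V
  adj_unit : adj unit = unit
  /-- the positive cone of `M_p(V)` -/
  cone : (p : ℕ) → Set (Matrix (Fin p) (Fin p) V)
  cone_adj : ∀ {p : ℕ} {X : Matrix (Fin p) (Fin p) V}, X ∈ cone p → matAdj adj X = X
  cone_add : ∀ {p : ℕ} {X Y : Matrix (Fin p) (Fin p) V},
    X ∈ cone p → Y ∈ cone p → X + Y ∈ cone p
  cone_compress : ∀ {p q : ℕ} (a : Matrix (Fin p) (Fin q) ℂ) {X : Matrix (Fin p) (Fin p) V},
    X ∈ cone p → compress a X ∈ cone q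
  cone_proper : ∀ {p : ℕ} {X : Matrix (Fin p) (Fin p) V}, X ∈ cone p → -X ∈ cone p → X = 0
  order_unit : ∀ {p : ℕ} (X : Matrix (Fin p) (Fin p) V), matAdj adj X = X →
    ∃ r : ℝ, 0 < r ∧ (r : ℂ) • diagUnit unit p + X ∈ cone p
  archimedean : ∀ {p : ℕ} (X : Matrix (Fin p) (Fin p) V),
    (∀ ε : ℝ, 0 < ε → (ε : ℂ) • diagUnit unit p + X ∈ cone p) → X ∈ cone p

namespace OperatorSystem

variable {V : Type u} [AddCommGroup V] [Module ℂ V] {W : Type v} [AddCommGroup W] [Module ℂ W]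

/-- `φ` is completely positive: every `φ^{(p)}` maps positive matrices to positive matrices. -/
def IsCP (𝒮 : OperatorSystem V) (𝒯 : OperatorSystem W) (φ : V →ₗ[ℂ] W) : Prop :=
  ∀ (p : ℕ), ∀ X ∈ 𝒮.cone p, X.map φ ∈ 𝒯.cone p

/-- `φ` is a complete order isomorphism: a linear isomorphism such that `φ` and `φ⁻¹` are
completely positive. -/
def IsCompleteOrderIso (𝒮 : OperatorSystem V) (𝒯 : OperatorSystem W) (φ : V →ₗ[ℂ] W) : Prop :=
  ∃ e : V ≃ₗ[ℂ] W, e.toLinearMap = φ ∧ 𝒮.IsCP 𝒯 e.toLinearMap ∧ 𝒯.IsCP 𝒮 e.symm.toLinearMap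

/-- A subspace is a kernel if it is the kernel of a completely positive map into some operator
system (in the universe of `V`, which also contains the quotient `V ⧸ J`). -/
def IsKernel (𝒮 : OperatorSystem V) (J : Submodule ℂ V) : Prop :=
  ∃ (W : Type u) (_ : AddCommGroup W) (_ : Module ℂ W) (𝒯 : OperatorSystem W) (φ : V →ₗ[ℂ] W),
    𝒮.IsCP 𝒯 φ ∧ J = LinearMap.ker φ

/-- `D_p(S/J)`: the classes of those selfadjoint `H ∈ M_p(S)` for which `H + K` is positive for
some selfadjoint `K ∈ M_p(J)`. -/
def D (𝒮 : OperatorSystem V) (J : Submodule ℂ V) (p : ℕ) : Set (Matrix (Fin p) (Fin p) (V ⧸ J)) :=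
  {x | ∃ H : Matrix (Fin p) (Fin p) V, matAdj 𝒮.adj H = H ∧ H.map J.mkQ = x ∧
    ∃ K : Matrix (Fin p) (Fin p) V, matAdj 𝒮.adj K = K ∧ (∀ i j, K i j ∈ J) ∧ H + K ∈ 𝒮.cone p}

/-- `C_p(S/J)`: the classes of those selfadjoint `H ∈ M_p(S)` such that, for every `ε > 0`,
`ε 1 + H + K` is positive for some selfadjoint `K ∈ M_p(J)`. -/
def C (𝒮 : OperatorSystem V) (J : Submodule ℂ V) (p : ℕ) : Set (Matrix (Fin p) (Fin p) (V ⧸ J)) :=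
  {x | ∃ H : Matrix (Fin p) (Fin p) V, matAdj 𝒮.adj H = H ∧ H.map J.mkQ = x ∧
    ∀ ε : ℝ, 0 < ε →
      ∃ K : Matrix (Fin p) (Fin p) V, matAdj 𝒮.adj K = K ∧ (∀ i j, K i j ∈ J) ∧
        (ε : ℂ) • diagUnit 𝒮.unit p + H + K ∈ 𝒮.cone p}

/-- A kernel `J` is completely order proximinal if `D_p(S/J) = C_p(S/J)` for every `p`. -/
def IsCompletelyOrderProximinal (𝒮 : OperatorSystem V) (J : Submodule ℂ V) : Prop :=
  𝒮.IsKernel J ∧ ∀ p : ℕ, 𝒮.D J p = 𝒮.C J p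

lemma matAdj_add (s : V →ₗ⋆[ℂ] V) {p : ℕ} (X Y : Matrix (Fin p) (Fin p) V) :
    matAdj s (X + Y) = matAdj s X + matAdj s Y := by
  ext i j; simp [matAdj]

lemma matAdj_sub (s : V →ₗ⋆[ℂ] V) {p : ℕ} (X Y : Matrix (Fin p) (Fin p) V) :
    matAdj s (X - Y) = matAdj s X - matAdj s Y := by
  ext i j; simp [matAdj]

lemma matAdj_smul (s : V →ₗ⋆[ℂ] V) {p : ℕ} (r : ℝ) (X : Matrix (Fin p) (Fin p) V) :
    matAdj s ((r : ℂ) • X) = (r : ℂ) • matAdj s X := by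
  ext i j
  simp only [matAdj, Matrix.of_apply, Matrix.smul_apply, map_smulₛₗ, Complex.conj_ofReal]

lemma matAdj_diagUnit (𝒮 : OperatorSystem V) (p : ℕ) :
    matAdj 𝒮.adj (diagUnit 𝒮.unit p) = diagUnit 𝒮.unit p := by
  ext i j
  by_cases h : i = j
  · subst h; simp [matAdj, diagUnit, 𝒮.adj_unit]
  · simp [matAdj, diagUnit, Matrix.diagonal_apply_ne _ h, Matrix.diagonal_apply_ne' _ h]

lemma matAdj_matAdj (𝒮 : OperatorSystem V) {p : ℕ} (X : Matrix (Fin p) (Fin p) V) :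
    matAdj 𝒮.adj (matAdj 𝒮.adj X) = X := by
  ext i j; simp [matAdj, 𝒮.adj_adj]

lemma compress_add {p q : ℕ} (a : Matrix (Fin p) (Fin q) ℂ) (X Y : Matrix (Fin p) (Fin p) V) :
    compress a (X + Y) = compress a X + compress a Y := by
  ext i j; simp [compress, Finset.sum_add_distrib]

lemma compress_smul {p q : ℕ} (a : Matrix (Fin p) (Fin q) ℂ) (c : ℂ)
    (X : Matrix (Fin p) (Fin p) V) : compress a (c • X) = c • compress a X := by
  ext i j
  simp only [compress, Matrix.of_apply, Matrix.smul_apply, Finset.smul_sum]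
  refine Finset.sum_congr rfl fun k _ => Finset.sum_congr rfl fun l _ => ?_
  rw [smul_comm]

lemma compress_map {p q : ℕ} (a : Matrix (Fin p) (Fin q) ℂ) (X : Matrix (Fin p) (Fin p) V)
    (φ : V →ₗ[ℂ] W) : (compress a X).map φ = compress a (X.map φ) := by
  ext i j; simp [compress]

lemma matAdj_compress (s : V →ₗ⋆[ℂ] V) {p q : ℕ} (a : Matrix (Fin p) (Fin q) ℂ)
    (X : Matrix (Fin p) (Fin p) V) : matAdj s (compress a X) = compress a (matAdj s X) := by
  ext i j
  simp only [matAdj, compress, Matrix.of_apply, map_sum]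
  rw [Finset.sum_comm]
  refine Finset.sum_congr rfl fun k _ => Finset.sum_congr rfl fun l _ => ?_
  simp [mul_comm]

lemma cone_smul (𝒮 : OperatorSystem V) {p : ℕ} {X : Matrix (Fin p) (Fin p) V} (t : ℝ)
    (ht : 0 ≤ t) (hX : X ∈ 𝒮.cone p) : (t : ℂ) • X ∈ 𝒮.cone p := by
  have h := 𝒮.cone_compress (Matrix.diagonal fun _ => ((Real.sqrt t : ℝ) : ℂ)) hX
  convert h using 1
  ext i j
  simp only [compress, Matrix.of_apply, Matrix.smul_apply]
  rw [Finset.sum_eq_single i, Finset.sum_eq_single j]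
  · simp [← Complex.ofReal_mul, Real.mul_self_sqrt ht]
  · intro b _ hb; simp [Matrix.diagonal_apply_ne _ hb]
  · simp
  · intro b _ hb; simp [Matrix.diagonal_apply_ne _ hb]
  · simp

lemma unit_mem (𝒮 : OperatorSystem V) (p : ℕ) : diagUnit 𝒮.unit p ∈ 𝒮.cone p := by
  obtain ⟨r, hr, h⟩ := 𝒮.order_unit (p := p) 0 (by ext i j; simp [matAdj])
  have := 𝒮.cone_smul r⁻¹ (by positivity) h
  rwa [add_zero, smul_smul, ← Complex.ofReal_mul, inv_mul_cancel₀ hr.ne', Complex.ofReal_one,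
    one_smul] at this

lemma map_smul_add (φ : V →ₗ[ℂ] W) {p : ℕ} (c : ℂ) (X Y : Matrix (Fin p) (Fin p) V) :
    (c • X + Y).map φ = c • X.map φ + Y.map φ := by
  ext i j; simp

lemma diagUnit_map (φ : V →ₗ[ℂ] W) (e : V) (p : ℕ) :
    (diagUnit e p).map φ = diagUnit (φ e) p := by
  simp [diagUnit, Matrix.diagonal_map]

lemma C_mem_iff (𝒮 : OperatorSystem V) (J : Submodule ℂ V) {p : ℕ}
    (x : Matrix (Fin p) (Fin p) (V ⧸ J)) :
    x ∈ 𝒮.C J p ↔ ∀ ε : ℝ, 0 < ε → ∃ Y ∈ 𝒮.cone p,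
      Y.map J.mkQ = (ε : ℂ) • diagUnit (J.mkQ 𝒮.unit) p + x := by
  constructor
  · rintro ⟨H, -, rfl, h⟩ ε hε
    obtain ⟨K, -, hK, hp⟩ := h ε hε
    refine ⟨_, hp, ?_⟩
    rw [add_assoc, map_smul_add, diagUnit_map]
    congr 1
    ext i j
    simp [(Submodule.Quotient.mk_eq_zero J).2 (hK i j)]
  · intro h
    obtain ⟨Y₁, hY₁, hx₁⟩ := h 1 one_pos
    have hs : matAdj 𝒮.adj (Y₁ - diagUnit 𝒮.unit p) = Y₁ - diagUnit 𝒮.unit p := by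
      rw [matAdj_sub, matAdj_diagUnit, 𝒮.cone_adj hY₁]
    have hx : (Y₁ - diagUnit 𝒮.unit p).map J.mkQ = x := by
      rw [Matrix.map_sub _ (map_sub _), hx₁, diagUnit_map]; simp
    refine ⟨_, hs, hx, fun ε hε => ?_⟩
    obtain ⟨Y, hY, hxY⟩ := h ε hε
    refine ⟨Y - ((ε : ℂ) • diagUnit 𝒮.unit p + (Y₁ - diagUnit 𝒮.unit p)), ?_, fun i j => ?_, ?_⟩
    · rw [matAdj_sub, matAdj_add, hs, matAdj_smul, matAdj_diagUnit, 𝒮.cone_adj hY]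
    · rw [← Submodule.ker_mkQ J, LinearMap.mem_ker]
      have : (Y - ((ε : ℂ) • diagUnit 𝒮.unit p + (Y₁ - diagUnit 𝒮.unit p))).map J.mkQ = 0 := by
        rw [Matrix.map_sub _ (map_sub _), map_smul_add, hx, hxY, diagUnit_map, sub_self]
      exact congrFun (congrFun this i) j
    · simpa using hY

lemma IsCP.map_adj {𝒮 : OperatorSystem V} {𝒯 : OperatorSystem W} {φ : V →ₗ[ℂ] W}
    (h : 𝒮.IsCP 𝒯 φ) (x : V) : φ (𝒮.adj x) = 𝒯.adj (φ x) := by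
  have key : ∀ y : V, 𝒮.adj y = y → 𝒯.adj (φ y) = φ y := by
    intro y hy
    obtain ⟨r, -, hr⟩ := 𝒮.order_unit (p := 1) (Matrix.of fun _ _ => y)
      (by ext i j; simp [matAdj, hy])
    have h1 := congrFun (congrFun (𝒯.cone_adj (h 1 _ hr)) 0) 0
    have h2 := congrFun (congrFun (𝒯.cone_adj (h 1 _ (𝒮.unit_mem 1))) 0) 0
    simp only [matAdj, diagUnit, Matrix.of_apply, Matrix.map_apply, Matrix.add_apply,
      Matrix.smul_apply, Matrix.diagonal_apply_eq, map_add, map_smul, map_smulₛₗ,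
      Complex.conj_ofReal] at h1 h2
    rw [h2] at h1
    exact add_left_cancel h1
  have h1 := key (x + 𝒮.adj x) (by rw [map_add, 𝒮.adj_adj, add_comm])
  have h2 := key (Complex.I • (x - 𝒮.adj x)) (by
    rw [map_smulₛₗ, map_sub, 𝒮.adj_adj, Complex.conj_I, neg_smul, ← smul_neg, neg_sub])
  simp only [map_add, map_smul, map_smulₛₗ, map_sub, Complex.conj_I, neg_smul, ← smul_neg,
    neg_sub] at h1 h2
  have h3 := smul_right_injective W Complex.I_ne_zero h2
  have h4 : (2 : ℂ) • φ (𝒮.adj x) = (2 : ℂ) • 𝒯.adj (φ x) := by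
    rw [two_smul, two_smul]
    have h5 := congrArg₂ (· - ·) h1 h3
    have e1 : 𝒯.adj (φ x) + 𝒯.adj (φ (𝒮.adj x)) - (𝒯.adj (φ (𝒮.adj x)) - 𝒯.adj (φ x)) =
      𝒯.adj (φ x) + 𝒯.adj (φ x) := by abel
    have e2 : φ x + φ (𝒮.adj x) - (φ x - φ (𝒮.adj x)) = φ (𝒮.adj x) + φ (𝒮.adj x) := by abel
    rw [e1, e2] at h5
    exact h5.symm
  exact smul_right_injective W two_ne_zero h4

lemma IsKernel.adj_mem {𝒮 : OperatorSystem V} {J : Submodule ℂ V} (hJ : 𝒮.IsKernel J) :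
    J ≤ J.comap 𝒮.adj := by
  obtain ⟨W, _, _, 𝒯, φ, hφ, rfl⟩ := hJ
  intro x hx
  rw [LinearMap.mem_ker] at hx
  simp [hφ.map_adj, hx]

/-- The linear map induced by a completely positive map on the quotient by its kernel maps the
cones `C_p` to positive matrices. -/
lemma IsCP.liftQ_mem {𝒮 : OperatorSystem V} {𝒯 : OperatorSystem W} {φ : V →ₗ[ℂ] W}
    (h : 𝒮.IsCP 𝒯 φ) {p : ℕ} {x : Matrix (Fin p) (Fin p) (V ⧸ LinearMap.ker φ)}
    (hx : x ∈ 𝒮.C (LinearMap.ker φ) p) :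
    x.map ((LinearMap.ker φ).liftQ φ le_rfl) ∈ 𝒯.cone p := by
  rw [C_mem_iff] at hx
  refine 𝒯.archimedean _ fun ε hε => ?_
  have h1 : matAdj 𝒯.adj (-diagUnit (φ 𝒮.unit) p) = -diagUnit (φ 𝒮.unit) p := by
    have := 𝒯.cone_adj (h p _ (𝒮.unit_mem p))
    rw [diagUnit_map] at this
    rw [← zero_sub, matAdj_sub, this]
    congr 1; ext i j; simp [matAdj]
  obtain ⟨r, hr, hru⟩ := 𝒯.order_unit _ h1
  obtain ⟨Y, hY, hYx⟩ := hx (ε / r) (by positivity)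
  have h2 := h p Y hY
  have h3 : Y.map φ = ((ε / r : ℝ) : ℂ) • diagUnit (φ 𝒮.unit) p +
      x.map ((LinearMap.ker φ).liftQ φ le_rfl) := by
    have := congrArg (fun M => Matrix.map M ((LinearMap.ker φ).liftQ φ le_rfl)) hYx
    simp only [map_smul_add, diagUnit_map, Matrix.map_map] at this
    exact this
  have h4 := 𝒯.cone_add (𝒯.cone_smul (ε / r) (by positivity) hru) h2
  rw [h3, smul_add, smul_smul, ← Complex.ofReal_mul, div_mul_cancel₀ _ hr.ne'] at h4
  simpa using h4

/-- The quotient operator system `(S/J, {C_p(S/J)}, q(1))` of an operator system by a kernel. -/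
def quotient (𝒮 : OperatorSystem V) (J : Submodule ℂ V) (hJ : 𝒮.IsKernel J) :
    OperatorSystem (V ⧸ J) where
  adj := J.mapQ J 𝒮.adj hJ.adj_mem
  adj_adj x := by
    obtain ⟨x, rfl⟩ := Submodule.Quotient.mk_surjective J x
    simp [𝒮.adj_adj]
  unit := J.mkQ 𝒮.unit
  adj_unit := by simp [𝒮.adj_unit]
  cone p := 𝒮.C J p
  cone_adj := by
    rintro p x ⟨H, hH, rfl, -⟩
    ext i j
    have := congrFun (congrFun hH i) j
    simp only [matAdj, Matrix.of_apply] at this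
    simp [matAdj, this]
  cone_add := by
    intro p x y hx hy
    rw [C_mem_iff] at *
    intro ε hε
    obtain ⟨X, hX, hXx⟩ := hx (ε / 2) (by positivity)
    obtain ⟨Y, hY, hYy⟩ := hy (ε / 2) (by positivity)
    refine ⟨X + Y, 𝒮.cone_add hX hY, ?_⟩
    rw [Matrix.map_add _ (map_add _), hXx, hYy, add_add_add_comm, ← add_smul, ← Complex.ofReal_add,
      add_halves]
  cone_compress := by
    intro p q a x hx
    rw [C_mem_iff] at *
    intro ε hε
    have hs : matAdj 𝒮.adj (-compress a (diagUnit 𝒮.unit p)) =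
        -compress a (diagUnit 𝒮.unit p) := by
      rw [← zero_sub, matAdj_sub, matAdj_compress, matAdj_diagUnit]
      congr 1; ext i j; simp [matAdj]
    obtain ⟨r, hr, hru⟩ := 𝒮.order_unit _ hs
    obtain ⟨Y, hY, hYx⟩ := hx (ε / r) (by positivity)
    refine ⟨_, 𝒮.cone_add (𝒮.cone_smul (ε / r) (by positivity) hru) (𝒮.cone_compress a hY), ?_⟩
    rw [map_smul_add, map_smul_add, compress_map, hYx, compress_add, compress_smul, smul_add,
      smul_smul, ← Complex.ofReal_mul, div_mul_cancel₀ _ hr.ne', diagUnit_map,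
      Matrix.map_neg _ (map_neg _), compress_map, diagUnit_map, smul_neg]
    abel
  cone_proper := by
    obtain ⟨W, _, _, 𝒯, φ, hφ, rfl⟩ := hJ
    intro p x hx hx'
    have h1 := hφ.liftQ_mem hx
    have h2 := hφ.liftQ_mem hx'
    rw [Matrix.map_neg _ (map_neg _)] at h2
    have h3 := 𝒯.cone_proper h1 h2
    ext i j
    have h4 := congrFun (congrFun h3 i) j
    have : LinearMap.ker ((LinearMap.ker φ).liftQ φ le_rfl) = ⊥ :=
      Submodule.ker_liftQ_eq_bot _ _ _ le_rfl
    exact (LinearMap.ker_eq_bot'.1 this) _ h4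
  order_unit := by
    intro p x hx
    choose H hH using fun i j => Submodule.Quotient.mk_surjective J (x i j)
    have hHx : (Matrix.of H).map J.mkQ = x := by ext i j; simp [hH]
    have hHx' : (matAdj 𝒮.adj (Matrix.of H)).map J.mkQ = x := by
      conv_rhs => rw [← hx]
      ext i j; simp [matAdj, ← hH]
    obtain ⟨r, hr, h⟩ := 𝒮.order_unit
      (((1 / 2 : ℝ) : ℂ) • (Matrix.of H + matAdj 𝒮.adj (Matrix.of H)))
      (by rw [matAdj_smul, matAdj_add, matAdj_matAdj, add_comm])
    refine ⟨r, hr, ?_⟩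
    rw [C_mem_iff]
    intro ε hε
    refine ⟨_, 𝒮.cone_add (𝒮.cone_smul ε hε.le (𝒮.unit_mem p)) h, ?_⟩
    rw [map_smul_add, map_smul_add, diagUnit_map]
    congr 2
    ext i j
    have h1 := congrFun (congrFun hHx i) j
    have h2 := congrFun (congrFun hHx' i) j
    simp only [Matrix.map_apply] at h1 h2
    simp only [Matrix.map_apply, Matrix.smul_apply, Matrix.add_apply, map_smul, map_add, h1, h2]
    rw [← two_smul ℂ (x i j), smul_smul]
    norm_num
  archimedean := by
    intro p x hx
    rw [C_mem_iff]
    intro ε hε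
    obtain ⟨Y, hY, hYx⟩ := (C_mem_iff 𝒮 J _).1 (hx (ε / 2) (by positivity)) (ε / 2) (by positivity)
    refine ⟨Y, hY, ?_⟩
    rw [hYx, ← add_assoc, ← add_smul, ← Complex.ofReal_add, add_halves]

lemma IsCP.isKernel {W : Type u} [AddCommGroup W] [Module ℂ W] {𝒮 : OperatorSystem V}
    {𝒯 : OperatorSystem W} {φ : V →ₗ[ℂ] W} (h : 𝒮.IsCP 𝒯 φ) : 𝒮.IsKernel (LinearMap.ker φ) :=
  ⟨W, _, _, 𝒯, φ, h, rfl⟩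

/-- `φ` is a complete quotient map: it is completely positive and the induced linear map
`S / ker φ → T` is a complete order isomorphism from the quotient operator system onto `T`. -/
def IsCompleteQuotientMap {W : Type u} [AddCommGroup W] [Module ℂ W] (𝒮 : OperatorSystem V)
    (𝒯 : OperatorSystem W) (φ : V →ₗ[ℂ] W) : Prop :=
  ∃ h : 𝒮.IsCP 𝒯 φ, (𝒮.quotient (LinearMap.ker φ) h.isKernel).IsCompleteOrderIso 𝒯
    ((LinearMap.ker φ).liftQ φ le_rfl)

end OperatorSystem

/-! ### Concrete operator systems in C*-algebras -/

namespace OperatorSystem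

section general

variable {E : Type*} [CStarAlgebra E] [PartialOrder E] [StarOrderedRing E]

lemma nonneg_iff_exists (x : E) : 0 ≤ x ↔ ∃ y, x = star y * y :=
  CStarAlgebra.nonneg_iff_eq_star_mul_self

lemma exists_smul_one_add_nonneg (x : E) (hx : star x = x) :
    ∃ r : ℝ, 0 < r ∧ 0 ≤ (r : ℂ) • (1 : E) + x := by
  have hx' : IsSelfAdjoint x := hx
  refine ⟨‖x‖ + 1, by positivity, ?_⟩
  have h1 : -(algebraMap ℝ E ‖x‖) ≤ x := hx'.neg_algebraMap_norm_le_self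
  have h2 : (0 : E) ≤ algebraMap ℝ E ‖x‖ + x := by
    simpa using add_le_add_right h1 (algebraMap ℝ E ‖x‖)
  have h3 : ((‖x‖ + 1 : ℝ) : ℂ) • (1 : E) + x = (algebraMap ℝ E ‖x‖ + x) + 1 := by
    rw [Algebra.algebraMap_eq_smul_one, Complex.coe_smul, add_smul, one_smul]
    abel
  rw [h3]
  exact add_nonneg h2 zero_le_one

lemma nonneg_of_forall_smul_one_add (x : E)
    (h : ∀ ε : ℝ, 0 < ε → 0 ≤ (ε : ℂ) • (1 : E) + x) : 0 ≤ x := by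
  have hl : Filter.Tendsto (fun ε : ℝ => (ε : ℂ) • (1 : E) + x) (nhdsWithin 0 (Set.Ioi 0))
      (nhds (((0 : ℝ) : ℂ) • (1 : E) + x)) := by
    apply Filter.Tendsto.mono_left _ nhdsWithin_le_nhds
    exact (Continuous.tendsto (by fun_prop) _)
  have := CStarAlgebra.isClosed_nonneg.mem_of_tendsto hl
    (Filter.eventually_of_mem self_mem_nhdsWithin fun ε hε => h ε hε)
  simpa using this

end general

section concrete

variable {A : Type u} [CStarAlgebra A]

/-- Positivity in the C*-algebra `M_p(A)`: `X = Y^* Y` for some `Y ∈ M_p(A)`. -/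
def IsPosMat {p : ℕ} (X : Matrix (Fin p) (Fin p) A) : Prop :=
  ∃ Y : Matrix (Fin p) (Fin p) A, X = Y.conjTranspose * Y

lemma isPosMat_iff [PartialOrder A] [StarOrderedRing A] {p : ℕ} (X : Matrix (Fin p) (Fin p) A) :
    IsPosMat X ↔ 0 ≤ CStarMatrix.ofMatrix X :=
  (nonneg_iff_exists (CStarMatrix.ofMatrix X)).symm

lemma isPosMat_rect [PartialOrder A] [StarOrderedRing A] {p q : ℕ}
    (Z : Matrix (Fin p) (Fin q) A) : IsPosMat (Z.conjTranspose * Z) := by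
  rcases q with _ | q
  · exact ⟨0, by ext i; exact i.elim0⟩
  let R : Fin p → Matrix (Fin (q + 1)) (Fin (q + 1)) A :=
    fun k => Matrix.of fun i j => if i = 0 then Z k j else 0
  have h1 : Z.conjTranspose * Z = ∑ k, (R k).conjTranspose * R k := by
    ext i j
    simp only [Matrix.mul_apply, Matrix.conjTranspose_apply, Matrix.sum_apply]
    refine Finset.sum_congr rfl fun k _ => ?_
    rw [Finset.sum_eq_single 0]
    · simp [R]
    · intro b _ hb; simp [R, hb]
    · simp
  rw [isPosMat_iff, h1]
  have h2 : CStarMatrix.ofMatrix (∑ k, (R k).conjTranspose * R k) =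
      ∑ k, CStarMatrix.ofMatrix ((R k).conjTranspose * R k) :=
    map_sum (CStarMatrix.ofMatrixₗ : Matrix (Fin (q + 1)) (Fin (q + 1)) A ≃ₗ[ℂ] _) _ _
  rw [h2]
  exact Finset.sum_nonneg fun k _ => (isPosMat_iff _).1 ⟨R k, rfl⟩

/-- The (concrete) operator system structure on a unital selfadjoint subspace `S` of a unital
C*-algebra `A`: the positive matrices over `S` are those that are positive in `M_p(A)`. -/
def ofSubspace (S : Submodule ℂ A) (h1 : (1 : A) ∈ S) (hs : ∀ x ∈ S, star x ∈ S) :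
    OperatorSystem S where
  adj :=
    { toFun := fun x => ⟨star x.1, hs x.1 x.2⟩
      map_add' := fun x y => Subtype.ext (star_add x.1 y.1)
      map_smul' := fun c x => Subtype.ext (star_smul c x.1) }
  adj_adj x := Subtype.ext (star_star x.1)
  unit := ⟨1, h1⟩
  adj_unit := Subtype.ext (star_one A)
  cone p := {X | IsPosMat (X.map S.subtype)}
  cone_adj := by
    rintro p X ⟨Y, hY⟩
    have h : (X.map S.subtype).conjTranspose = X.map S.subtype := by
      rw [hY, Matrix.conjTranspose_mul, Matrix.conjTranspose_conjTranspose]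
    ext i j
    exact congrFun (congrFun h i) j
  cone_add := by
    let _ := CStarAlgebra.spectralOrder A
    let _ := CStarAlgebra.spectralOrderedRing A
    intro p X Y hX hY
    rw [Set.mem_ofPred_eq, isPosMat_iff] at *
    exact add_nonneg hX hY
  cone_compress := by
    let _ := CStarAlgebra.spectralOrder A
    let _ := CStarAlgebra.spectralOrderedRing A
    rintro p q a X ⟨Y, hY⟩
    have h : (compress a X).map S.subtype =
        (Y * a.map (algebraMap ℂ A)).conjTranspose * (Y * a.map (algebraMap ℂ A)) := by
      rw [Matrix.conjTranspose_mul, ← Matrix.mul_assoc, Matrix.mul_assoc _ _ Y, ← hY]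
      ext k l
      simp only [compress, Matrix.map_apply, Matrix.of_apply, map_sum, map_smul, Matrix.mul_apply,
        Matrix.conjTranspose_apply, Finset.sum_mul]
      rw [Finset.sum_comm]
      refine Finset.sum_congr rfl fun i _ => Finset.sum_congr rfl fun j _ => ?_
      rw [← algebraMap_star_comm, ← Algebra.smul_def, ← Algebra.commutes, ← Algebra.smul_def,
        smul_smul, mul_comm]
      rfl
    rw [Set.mem_ofPred_eq, h]
    exact isPosMat_rect _
  cone_proper := by
    let _ := CStarAlgebra.spectralOrder A
    let _ := CStarAlgebra.spectralOrderedRing A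
    intro p X hX hX'
    rw [Set.mem_ofPred_eq, isPosMat_iff] at *
    have h : CStarMatrix.ofMatrix (X.map S.subtype) = 0 := by
      refine le_antisymm ?_ hX
      have h2 : CStarMatrix.ofMatrix ((-X).map S.subtype) =
        -CStarMatrix.ofMatrix (X.map S.subtype) := by ext i j; rfl
      rw [h2] at hX'
      exact neg_nonneg.1 hX'
    ext i j
    exact congrFun (congrFun h i) j
  order_unit := by
    let _ := CStarAlgebra.spectralOrder A
    let _ := CStarAlgebra.spectralOrderedRing A
    intro p X hX
    obtain ⟨r, hr, h⟩ := exists_smul_one_add_nonneg (CStarMatrix.ofMatrix (X.map S.subtype)) (by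
      ext i j
      exact congrArg Subtype.val (congrFun (congrFun hX i) j))
    refine ⟨r, hr, ?_⟩
    rw [Set.mem_ofPred_eq, isPosMat_iff, map_smul_add, diagUnit_map]
    exact h
  archimedean := by
    let _ := CStarAlgebra.spectralOrder A
    let _ := CStarAlgebra.spectralOrderedRing A
    intro p X hX
    rw [Set.mem_ofPred_eq, isPosMat_iff]
    refine nonneg_of_forall_smul_one_add _ fun ε hε => ?_
    have := hX ε hε
    rw [Set.mem_ofPred_eq, isPosMat_iff, map_smul_add, diagUnit_map] at this
    exact this

end concrete
end OperatorSystem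

/-- The complex group algebra `ℂ[G]`, which will carry its largest C*-seminorm. -/
def GroupStarAlg (G : Type*) [Group G] : Type _ := MonoidAlgebra ℂ G

namespace GroupStarAlg

variable {G : Type*} [Group G]

instance : Ring (GroupStarAlg G) := inferInstanceAs (Ring (MonoidAlgebra ℂ G))
instance : Algebra ℂ (GroupStarAlg G) := inferInstanceAs (Algebra ℂ (MonoidAlgebra ℂ G))

/-- The element `c g` of the group algebra. -/
def single (g : G) (c : ℂ) : GroupStarAlg G := MonoidAlgebra.single g c

lemma single_mul (g h : G) (c d : ℂ) : single g c * single h d = single (g * h) (c * d) :=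
  MonoidAlgebra.single_mul_single ..

lemma single_one_one : single (1 : G) 1 = 1 := rfl

lemma smul_single (g : G) (c d : ℂ) : c • single g d = single g (c * d) :=
  MonoidAlgebra.smul_single ..

lemma single_zero (g : G) : single g 0 = 0 := MonoidAlgebra.single_zero ..

lemma single_add (g : G) (c d : ℂ) : single g (c + d) = single g c + single g d :=
  MonoidAlgebra.single_add ..

lemma induction {P : GroupStarAlg G → Prop} (x : GroupStarAlg G) (h0 : P 0)
    (ha : ∀ x y, P x → P y → P (x + y)) (hs : ∀ g c, P (single g c)) : P x :=
  MonoidAlgebra.induction_linear (motive := P) x h0 ha hs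

/-- The involution `∑ c_g g ↦ ∑ conj(c_g) g⁻¹`. -/
def starHom : GroupStarAlg G →+ GroupStarAlg G :=
  (Finsupp.liftAddHom fun g : G =>
    ({ toFun := fun c => single g⁻¹ (conj c)
       map_zero' := by rw [map_zero, single_zero]
       map_add' := fun c d => by rw [map_add, single_add] } : ℂ →+ GroupStarAlg G)).comp
    (MonoidAlgebra.coeffAddEquiv (R := ℂ) (M := G)).toAddMonoidHom

lemma starHom_single (g : G) (c : ℂ) : starHom (single g c) = single g⁻¹ (conj c) := by
  have := Finsupp.liftAddHom_apply_single (fun g : G =>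
    ({ toFun := fun c => single g⁻¹ (conj c)
       map_zero' := by rw [map_zero, single_zero]
       map_add' := fun c d => by rw [map_add, single_add] } : ℂ →+ GroupStarAlg G)) g c
  exact this

instance : StarRing (GroupStarAlg G) where
  star := starHom
  star_involutive x := by
    induction x using induction with
    | h0 => simp
    | ha x y hx hy => rw [map_add, map_add, hx, hy]
    | hs g c => simp [starHom_single]
  star_mul x y := by
    change starHom (x * y) = starHom y * starHom x
    induction x using induction with
    | h0 => simp
    | ha x x' hx hx' => rw [add_mul, map_add, map_add, mul_add, hx, hx']
    | hs g c =>
      induction y using induction with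
      | h0 => simp
      | ha x x' hx hx' => rw [mul_add, map_add, map_add, add_mul, hx, hx']
      | hs h d => simp [starHom_single, single_mul, mul_comm]
  star_add x y := map_add starHom x y

lemma star_single (g : G) (c : ℂ) : star (single g c) = single g⁻¹ (conj c) :=
  starHom_single g c

instance : StarModule ℂ (GroupStarAlg G) where
  star_smul c x := by
    induction x using induction with
    | h0 => simp
    | ha x y hx hy => rw [smul_add, star_add, star_add, smul_add, hx, hy]
    | hs g d => simp [star_single, smul_single]

/-- A C*-seminorm: a submultiplicative seminorm with `‖x^* x‖ = ‖x‖²`. -/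
structure CStarSeminorm (G : Type*) [Group G] extends Seminorm ℂ (GroupStarAlg G) where
  mul_le' : ∀ x y, toFun (x * y) ≤ toFun x * toFun y
  star_mul_self' : ∀ x, toFun (star x * x) = toFun x ^ 2

namespace CStarSeminorm

variable (p : CStarSeminorm G)

lemma mul_le (x y : GroupStarAlg G) : p.toSeminorm (x * y) ≤ p.toSeminorm x * p.toSeminorm y :=
  p.mul_le' x y

lemma star_mul_self (x : GroupStarAlg G) : p.toSeminorm (star x * x) = p.toSeminorm x ^ 2 :=
  p.star_mul_self' x

lemma map_star (x : GroupStarAlg G) : p.toSeminorm (star x) = p.toSeminorm x := by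
  have key : ∀ y : GroupStarAlg G, p.toSeminorm y ≤ p.toSeminorm (star y) := by
    intro y
    have h1 := p.star_mul_self y
    have h2 := p.mul_le (star y) y
    have h3 := apply_nonneg p.toSeminorm y
    have h4 := apply_nonneg p.toSeminorm (star y)
    rcases h3.eq_or_lt with h | h
    · rw [← h]; exact h4
    · nlinarith
  refine le_antisymm ?_ (key x)
  simpa using key (star x)

lemma single_le (g : G) (c : ℂ) : p.toSeminorm (single g c) ≤ ‖c‖ := by
  have h1 : p.toSeminorm (1 : GroupStarAlg G) ≤ 1 := by
    have h := p.star_mul_self (1 : GroupStarAlg G)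
    rw [star_one, one_mul] at h
    nlinarith [apply_nonneg p.toSeminorm (1 : GroupStarAlg G)]
  have h2 : p.toSeminorm (single g 1) ≤ 1 := by
    have h := p.star_mul_self (single g 1)
    rw [star_single, single_mul, inv_mul_cancel, map_one, one_mul, single_one_one] at h
    nlinarith [apply_nonneg p.toSeminorm (single g 1)]
  have h3 : single g c = c • single g (1 : ℂ) := by rw [smul_single, mul_one]
  rw [h3, map_smul_eq_mul]
  exact mul_le_of_le_one_right (norm_nonneg c) h2

end CStarSeminorm

instance : Inhabited (CStarSeminorm G) where
  default :=
    { toSeminorm := 0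
      mul_le' := fun x y => by
        change (0 : ℝ) ≤ 0 * 0
        simp
      star_mul_self' := fun x => by
        change (0 : ℝ) = 0 ^ 2
        simp }

lemma bddAbove (x : GroupStarAlg G) :
    BddAbove (Set.range fun p : CStarSeminorm G => p.toSeminorm x) := by
  induction x using induction with
  | h0 => exact ⟨0, by rintro _ ⟨p, rfl⟩; simp⟩
  | ha x y hx hy =>
    obtain ⟨a, ha⟩ := hx
    obtain ⟨b, hb⟩ := hy
    exact ⟨a + b, by
      rintro _ ⟨p, rfl⟩
      exact (map_add_le_add p.toSeminorm x y).trans (add_le_add (ha ⟨p, rfl⟩) (hb ⟨p, rfl⟩))⟩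
  | hs g c => exact ⟨‖c‖, by rintro _ ⟨p, rfl⟩; exact p.single_le g c⟩

/-- The full group C*-norm: the largest C*-seminorm on the group algebra. -/
def fullNorm (x : GroupStarAlg G) : ℝ := ⨆ p : CStarSeminorm G, p.toSeminorm x

lemma le_fullNorm (p : CStarSeminorm G) (x : GroupStarAlg G) : p.toSeminorm x ≤ fullNorm x :=
  le_ciSup (bddAbove x) p

lemma fullNorm_nonneg (x : GroupStarAlg G) : 0 ≤ fullNorm x :=
  (apply_nonneg (default : CStarSeminorm G).toSeminorm x).trans (le_fullNorm _ x)

lemma fullNorm_star (x : GroupStarAlg G) : fullNorm (star x) = fullNorm x := by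
  simp only [fullNorm, CStarSeminorm.map_star]

lemma fullNorm_star_mul_self (x : GroupStarAlg G) :
    fullNorm x * fullNorm x ≤ fullNorm (star x * x) := by
  have h : fullNorm x ≤ Real.sqrt (fullNorm (star x * x)) := by
    refine ciSup_le fun p => Real.le_sqrt_of_sq_le ?_
    rw [← p.star_mul_self]
    exact le_fullNorm p _
  calc fullNorm x * fullNorm x ≤ Real.sqrt (fullNorm (star x * x)) *
        Real.sqrt (fullNorm (star x * x)) :=
        mul_self_le_mul_self (fullNorm_nonneg x) h
    _ = _ := Real.mul_self_sqrt (fullNorm_nonneg _)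

/-- The full group C*-norm as a ring seminorm. -/
def fullRingSeminorm : RingSeminorm (GroupStarAlg G) where
  toFun := fullNorm
  map_zero' := by simp [fullNorm]
  add_le' x y := ciSup_le fun p => (map_add_le_add p.toSeminorm x y).trans
    (add_le_add (le_fullNorm p x) (le_fullNorm p y))
  neg' x := by simp [fullNorm]
  mul_le' x y := ciSup_le fun p => (p.mul_le x y).trans
    (mul_le_mul (le_fullNorm p x) (le_fullNorm p y) (apply_nonneg _ _) (fullNorm_nonneg x))

instance : SeminormedRing (GroupStarAlg G) := fullRingSeminorm.toSeminormedRing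

lemma norm_def (x : GroupStarAlg G) : ‖x‖ = fullNorm x := rfl

instance : NormedAlgebra ℂ (GroupStarAlg G) where
  norm_smul_le c x := by
    rw [norm_def, norm_def]
    refine ciSup_le fun p => ?_
    rw [map_smul_eq_mul]
    exact mul_le_mul_of_nonneg_left (le_fullNorm p x) (norm_nonneg c)

instance : NormedStarGroup (GroupStarAlg G) where
  norm_star_le x := (fullNorm_star x).le

lemma uniformContinuous_star : UniformContinuous (star : GroupStarAlg G → GroupStarAlg G) :=
  (starNormedAddGroupHom (E := GroupStarAlg G)).uniformContinuous

end GroupStarAlg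

/-- The full group C*-algebra `C*(G)`: the completion of the group algebra (modulo null vectors)
for its largest C*-seminorm. -/
def FullGroupCStar (G : Type*) [Group G] : Type _ := UniformSpace.Completion (GroupStarAlg G)

namespace FullGroupCStar

open UniformSpace

variable {G : Type*} [Group G]

instance : NormedRing (FullGroupCStar G) :=
  inferInstanceAs (NormedRing (Completion (GroupStarAlg G)))

instance : CompleteSpace (FullGroupCStar G) :=
  inferInstanceAs (CompleteSpace (Completion (GroupStarAlg G)))

instance : Algebra ℂ (FullGroupCStar G) :=
  inferInstanceAs (Algebra ℂ (Completion (GroupStarAlg G)))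

instance : NormedAlgebra ℂ (FullGroupCStar G) where
  norm_smul_le := norm_smul_le (α := ℂ) (β := Completion (GroupStarAlg G))

/-- The canonical map of the group algebra into `C*(G)`. -/
def ofAlg : GroupStarAlg G →ₐ[ℂ] FullGroupCStar G where
  toFun x := (x : Completion (GroupStarAlg G))
  map_one' := rfl
  map_mul' x y := Completion.coe_mul x y
  map_zero' := rfl
  map_add' x y := Completion.coe_add x y
  commutes' _ := rfl

lemma norm_ofAlg (x : GroupStarAlg G) : ‖ofAlg x‖ = ‖x‖ := Completion.norm_coe x

lemma continuous_ofAlg : Continuous (ofAlg : GroupStarAlg G → FullGroupCStar G) :=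
  Completion.continuous_coe _

lemma denseRange_ofAlg : DenseRange (ofAlg : GroupStarAlg G → FullGroupCStar G) :=
  Completion.denseRange_coe

instance : Star (FullGroupCStar G) where
  star := Completion.map (star : GroupStarAlg G → GroupStarAlg G)

lemma star_ofAlg (x : GroupStarAlg G) : star (ofAlg x) = ofAlg (star x) :=
  Completion.map_coe GroupStarAlg.uniformContinuous_star x

lemma continuous_star' : Continuous (star : FullGroupCStar G → FullGroupCStar G) :=
  Completion.continuous_map

instance : StarRing (FullGroupCStar G) where
  star_involutive x := by
    refine denseRange_ofAlg.induction_on (p := fun x => star (star x) = x) x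
      (isClosed_eq (continuous_star'.comp continuous_star') continuous_id) fun x => ?_
    rw [star_ofAlg, star_ofAlg, star_star]
  star_mul x y := by
    refine denseRange_ofAlg.induction_on₂ (p := fun x y => star (x * y) = star y * star x)
      (isClosed_eq (continuous_star'.comp continuous_mul)
        ((continuous_star'.comp continuous_snd).mul (continuous_star'.comp continuous_fst)))
      (fun x y => ?_) x y
    rw [← map_mul, star_ofAlg, star_ofAlg, star_ofAlg, star_mul, map_mul]
  star_add x y := by
    refine denseRange_ofAlg.induction_on₂ (p := fun x y => star (x + y) = star x + star y)
      (isClosed_eq (continuous_star'.comp continuous_add)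
        ((continuous_star'.comp continuous_fst).add (continuous_star'.comp continuous_snd)))
      (fun x y => ?_) x y
    rw [← map_add, star_ofAlg, star_ofAlg, star_ofAlg, star_add, map_add]

instance : StarModule ℂ (FullGroupCStar G) where
  star_smul c x := by
    refine denseRange_ofAlg.induction_on (p := fun x => star (c • x) = star c • star x) x
      (isClosed_eq (continuous_star'.comp (continuous_const_smul c))
        ((continuous_const_smul (star c)).comp continuous_star')) fun x => ?_
    rw [← map_smul, star_ofAlg, star_ofAlg, star_smul, map_smul]

instance : CStarRing (FullGroupCStar G) where
  norm_mul_self_le x := by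
    refine denseRange_ofAlg.induction_on (p := fun x => ‖x‖ * ‖x‖ ≤ ‖star x * x‖) x
      (isClosed_le (continuous_norm.mul continuous_norm)
        (continuous_norm.comp (continuous_star'.mul continuous_id))) fun x => ?_
    rw [star_ofAlg, ← map_mul, norm_ofAlg, norm_ofAlg]
    exact GroupStarAlg.fullNorm_star_mul_self x

instance : CStarAlgebra (FullGroupCStar G) where

/-- The canonical unitary of `C*(G)` attached to `g`. -/
def of (g : G) : FullGroupCStar G := ofAlg (GroupStarAlg.single g 1)

end FullGroupCStar

/-- The family `u` consists of universal unitaries that generate the unital C*-algebra `A`: every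
family of unitaries of the same size in a unital C*-algebra is the image of `u` under a unital
`*`-homomorphism. (Target algebras in the universe of `A` already determine the pair `(A, u)` up to
isomorphism.) -/
structure IsUniversalUnitaries {A : Type} [CStarAlgebra A] {ι : Type*} (u : ι → A) : Prop where
  unitary : ∀ i, u i ∈ unitary A
  generate : (StarAlgebra.adjoin ℂ (Set.range u)).topologicalClosure = ⊤
  universal : ∀ (B : Type) [CStarAlgebra B] (v : ι → B), (∀ i, v i ∈ _root_.unitary B) →
    ∃ π : A →⋆ₐ[ℂ] B, ∀ i, π (u i) = v i

namespace GroupStarAlg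

variable {G : Type*} [Group G] {B : Type*} [CStarAlgebra B]

/-- The `*`-representation of the group algebra induced by a unitary representation. -/
def rep (F : G →* unitary B) : GroupStarAlg G →ₐ[ℂ] B :=
  MonoidAlgebra.lift ℂ B G ((unitary B).subtype.comp F)

lemma rep_single (F : G →* unitary B) (g : G) (c : ℂ) : rep F (single g c) = c • (F g : B) :=
  MonoidAlgebra.lift_single ..

lemma rep_star (F : G →* unitary B) (x : GroupStarAlg G) : rep F (star x) = star (rep F x) := by
  induction x using induction with
  | h0 => simp
  | ha x y hx hy => rw [star_add, map_add, map_add, star_add, hx, hy]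
  | hs g c =>
    rw [star_single, rep_single, rep_single, star_smul, map_inv, ← Unitary.star_eq_inv]
    rfl

lemma norm_rep_le (F : G →* unitary B) (x : GroupStarAlg G) : ‖rep F x‖ ≤ ‖x‖ :=
  le_fullNorm
    { toSeminorm := (normSeminorm ℂ B).comp (rep F).toLinearMap
      mul_le' := fun x y => by
        change ‖rep F (x * y)‖ ≤ ‖rep F x‖ * ‖rep F y‖
        rw [map_mul]
        exact norm_mul_le _ _
      star_mul_self' := fun x => by
        change ‖rep F (star x * x)‖ = ‖rep F x‖ ^ 2
        rw [map_mul, rep_star, CStarRing.norm_star_mul_self, sq] } x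

end GroupStarAlg

namespace FullGroupCStar

open UniformSpace

variable {G : Type*} [Group G]

lemma of_mul (g h : G) : of (g * h) = of g * of h := by
  rw [of, of, of, ← map_mul, GroupStarAlg.single_mul, one_mul]

lemma of_one : of (1 : G) = 1 := rfl

lemma star_of (g : G) : star (of g) = of g⁻¹ := by
  rw [of, of, star_ofAlg, GroupStarAlg.star_single, map_one]

/-- The universal property of `C*(G)`: unitary representations of `G` extend. -/
lemma exists_lift {B : Type*} [CStarAlgebra B] (F : G →* unitary B) :
    ∃ π : FullGroupCStar G →⋆ₐ[ℂ] B, ∀ g, π (of g) = (F g : B) := by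
  have hc : Continuous (GroupStarAlg.rep F) :=
    AddMonoidHomClass.continuous_of_bound (GroupStarAlg.rep F) 1
      (fun x => by rw [one_mul]; exact GroupStarAlg.norm_rep_le F x)
  let ρ : FullGroupCStar G →+* B :=
    Completion.extensionHom (GroupStarAlg.rep F : GroupStarAlg G →+* B) hc
  have hρ : ∀ x, ρ (ofAlg x) = GroupStarAlg.rep F x :=
    Completion.extensionHom_coe (GroupStarAlg.rep F : GroupStarAlg G →+* B) hc
  have hρc : Continuous ρ := Completion.continuous_extension
  refine ⟨{ ρ with
            commutes' := fun c => ?_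
            map_star' := fun x => ?_ }, fun g => ?_⟩
  · change ρ (algebraMap ℂ _ c) = _
    rw [← ofAlg.commutes c, hρ, AlgHom.commutes]
  · change ρ (star x) = star (ρ x)
    refine denseRange_ofAlg.induction_on (p := fun x => ρ (star x) = star (ρ x)) x
      (isClosed_eq (hρc.comp continuous_star') (continuous_star.comp hρc)) fun x => ?_
    rw [star_ofAlg, hρ, hρ, GroupStarAlg.rep_star]
  · change ρ (of g) = _
    rw [of, hρ, GroupStarAlg.rep_single, one_smul]

end FullGroupCStar

/-- The free generators are universal unitaries that generate `C*(F)`. -/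
theorem isUniversalUnitaries_of (ι : Type) :
    IsUniversalUnitaries fun i : ι => FullGroupCStar.of (FreeGroup.of i) where
  unitary i := by
    rw [Unitary.mem_iff, FullGroupCStar.star_of, ← FullGroupCStar.of_mul, ← FullGroupCStar.of_mul,
      inv_mul_cancel, mul_inv_cancel, FullGroupCStar.of_one]
    exact ⟨rfl, rfl⟩
  generate := by
    set S := StarAlgebra.adjoin ℂ (Set.range fun i : ι => FullGroupCStar.of (FreeGroup.of i))
    have h1 : ∀ g : FreeGroup ι, FullGroupCStar.of g ∈ S := by
      intro g
      induction g using FreeGroup.induction_on with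
      | C1 => exact one_mem S
      | of i => exact StarAlgebra.subset_adjoin ℂ _ ⟨i, rfl⟩
      | inv_of i hi =>
        rw [← FullGroupCStar.star_of]
        exact star_mem hi
      | mul g h hg hh =>
        rw [FullGroupCStar.of_mul]
        exact mul_mem hg hh
    have h2 : ∀ x : GroupStarAlg (FreeGroup ι), FullGroupCStar.ofAlg x ∈ S := by
      intro x
      induction x using GroupStarAlg.induction with
      | h0 => rw [map_zero]; exact zero_mem S
      | ha x y hx hy => rw [map_add]; exact add_mem hx hy
      | hs g c =>
        have : GroupStarAlg.single g c = c • GroupStarAlg.single g (1 : ℂ) := by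
          rw [GroupStarAlg.smul_single, mul_one]
        rw [this, map_smul]
        exact SMulMemClass.smul_mem c (h1 g)
    refine eq_top_iff.2 fun x _ => ?_
    have h3 := FullGroupCStar.denseRange_ofAlg x
    refine closure_mono ?_ h3
    rintro _ ⟨y, rfl⟩
    exact h2 y
  universal B _ v hv := by
    obtain ⟨π, hπ⟩ := FullGroupCStar.exists_lift
      (FreeGroup.lift fun i => (⟨v i, hv i⟩ : _root_.unitary B))
    exact ⟨π, fun i => by rw [hπ, FreeGroup.lift_apply_of]⟩

/-! ### Tridiagonal matrices and the map into the span of universal unitaries -/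

namespace Tridiag

open scoped Matrix.Norms.L2Operator

/-- The tridiagonal matrices `T_n = {A ∈ M_n : A_{ij} = 0 whenever |i - j| ≥ 2}`. -/
def T (n : ℕ) : Submodule ℂ (Matrix (Fin n) (Fin n) ℂ) where
  carrier := {A | ∀ i j : Fin n, 2 ≤ |(i : ℤ) - (j : ℤ)| → A i j = 0}
  zero_mem' := fun _ _ _ => rfl
  add_mem' := fun hA hB i j h => by rw [Matrix.add_apply, hA i j h, hB i j h, add_zero]
  smul_mem' := fun c A hA i j h => by rw [Matrix.smul_apply, hA i j h, smul_zero]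

/-- The diagonal matrices of trace zero, `J_n ⊆ M_n`. -/
def J (n : ℕ) : Submodule ℂ (Matrix (Fin n) (Fin n) ℂ) where
  carrier := {A | A.IsDiag ∧ A.trace = 0}
  zero_mem' := ⟨Matrix.isDiag_zero, Matrix.trace_zero _ _⟩
  add_mem' := fun hA hB => ⟨hA.1.add hB.1, by rw [Matrix.trace_add, hA.2, hB.2, add_zero]⟩
  smul_mem' := fun c A hA => ⟨hA.1.smul c, by rw [Matrix.trace_smul, hA.2, smul_zero]⟩

/-- `T_n` as an operator system in the C*-algebra `M_n`. -/
def TSys (n : ℕ) : OperatorSystem (T n) :=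
  OperatorSystem.ofSubspace (T n)
    (fun i j h => Matrix.one_apply_ne (by rintro rfl; simp at h))
    (fun A hA i j h => by
      rw [Matrix.star_apply, hA j i (by rwa [abs_sub_comm]), star_zero])

variable {A : Type} [CStarAlgebra A]

/-- The span of `1`, the `u_j` and the `u_j^*`. -/
def S {k : ℕ} (u : Fin k → A) : Submodule ℂ A :=
  Submodule.span ℂ ({1} ∪ Set.range u ∪ Set.range fun j => star (u j))

lemma one_mem_S {k : ℕ} (u : Fin k → A) : (1 : A) ∈ S u :=
  Submodule.subset_span (Or.inl (Or.inl rfl))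

lemma mem_S {k : ℕ} (u : Fin k → A) (j : Fin k) : u j ∈ S u :=
  Submodule.subset_span (Or.inl (Or.inr ⟨j, rfl⟩))

lemma star_mem_S {k : ℕ} (u : Fin k → A) (j : Fin k) : star (u j) ∈ S u :=
  Submodule.subset_span (Or.inr ⟨j, rfl⟩)

lemma S_star {k : ℕ} (u : Fin k → A) : ∀ x ∈ S u, star x ∈ S u := by
  intro x hx
  induction hx using Submodule.span_induction with
  | mem x h =>
    rcases h with (h | ⟨j, rfl⟩) | ⟨j, rfl⟩
    · rw [Set.mem_singleton_iff] at h
      rw [h, star_one]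
      exact one_mem_S u
    · exact star_mem_S u j
    · rw [star_star]
      exact mem_S u j
  | zero => rw [star_zero]; exact zero_mem _
  | add x y _ _ hx hy => rw [star_add]; exact add_mem hx hy
  | smul c x _ hx => rw [star_smul]; exact Submodule.smul_mem _ _ hx

/-- The span of `1`, the `u_j` and the `u_j^*`, as an operator system in the C*-algebra `A`. -/
def SSys {k : ℕ} (u : Fin k → A) : OperatorSystem (S u) :=
  OperatorSystem.ofSubspace (S u) (one_mem_S u) (S_star u)

/-- `1` on the diagonal, `u_i` at `(i, i + 1)`, `u_i^*` at `(i + 1, i)`, and `0` elsewhere. -/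
def band {n : ℕ} (u : Fin (n - 1) → A) (i j : Fin n) : A :=
  if i = j then 1
  else if h : i.val + 1 = j.val then u ⟨i.val, by omega⟩
  else if h : j.val + 1 = i.val then star (u ⟨j.val, by omega⟩)
  else 0

lemma band_mem {n : ℕ} (u : Fin (n - 1) → A) (i j : Fin n) : band u i j ∈ S u := by
  unfold band
  split_ifs
  · exact one_mem_S u
  · exact mem_S u _
  · exact star_mem_S u _
  · exact zero_mem _

/-- The linear map `φ` with `φ(E_{ii}) = 1/n`, `φ(E_{i,i+1}) = u_i/n` and
`φ(E_{i+1,i}) = u_i^*/n`. -/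
def phi {n : ℕ} (u : Fin (n - 1) → A) : T n →ₗ[ℂ] S u where
  toFun X := ∑ i, ∑ j, (X.1 i j * (1 / (n : ℂ))) • ⟨band u i j, band_mem u i j⟩
  map_add' X Y := by
    simp only [Submodule.coe_add, Matrix.add_apply, add_mul, add_smul, Finset.sum_add_distrib]
  map_smul' c X := by
    simp only [Submodule.coe_smul, Matrix.smul_apply, smul_eq_mul, mul_assoc, mul_smul,
      Finset.smul_sum, RingHom.id_apply]

lemma single_mem_T {n : ℕ} (i j : Fin n) (h : |(i : ℤ) - (j : ℤ)| ≤ 1) :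
    Matrix.single i j (1 : ℂ) ∈ T n := by
  intro k l hkl
  refine Matrix.single_apply_of_ne _ _ _ _ _ ?_
  rintro ⟨rfl, rfl⟩
  omega

lemma phi_single {n : ℕ} (u : Fin (n - 1) → A) (i j : Fin n) (h : |(i : ℤ) - (j : ℤ)| ≤ 1) :
    (phi u ⟨Matrix.single i j 1, single_mem_T i j h⟩ : A) = (1 / (n : ℂ)) • band u i j := by
  simp only [phi, LinearMap.coe_mk, AddHom.coe_mk, AddSubmonoidClass.coe_finsetSum,
    Submodule.coe_smul]
  rw [Finset.sum_eq_single i, Finset.sum_eq_single j]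
  · simp
  · intro l _ hl
    simp [hl.symm]
  · simp
  · intro k _ hk
    simp [hk.symm]
  · simp

end Tridiag

end

/-!
Write a family of unitaries as `u_j = W_j⁻¹ W_{j+1}`. On the band the matrix `band u` then agrees
with the positive matrix `[W_k^* W_l]`, so `φ` is a compression of a Schur product with a positive
matrix and hence completely positive.

Conversely let `φ(X)` be positive. By duality, positivity of `X` modulo `M_p(J_n)` means
`tr(G X) ≥ 0` for all positive `G` annihilating `M_p(J_n)`; the cone of such `X` is closed because
`M_p(J_n)` consists of matrices of trace zero. If `y_{a,k}` are Gram vectors of `Gᵀ`, annihilating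
`M_p(J_n)` means that the family `(y_{a,k})_a` has the same Gram matrix for every `k`, so that
`y_{a,k} = W_k y_{a,0}` for unitaries `W_k` of a finite dimensional Hilbert space. The
representation sending `u_j` to `W_j⁻¹ W_{j+1}` exhibits `tr(G X)` as `n` times a value of the
positive form given by `φ(X)`. Thus positive matrices lift exactly, which gives proximinality and
the quotient property. The kernel is `J_n` because positive matrices of trace zero vanish.
-/

section

open OpSys

universe u v

namespace OperatorSystem

section Quotient

variable {V : Type u} {W : Type v} [AddCommGroup V] [Module ℂ V] [AddCommGroup W] [Module ℂ W]
  {𝒮 : OperatorSystem V} {𝒯 : OperatorSystem W} {φ : V →ₗ[ℂ] W}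

/-- Every positive matrix over `𝒯` is the image under `φ` of a positive matrix over `𝒮`. For
completely positive `φ` this is what makes the induced map on the quotient by `ker φ` a complete
order isomorphism without the perturbations by `ε` in `C`. -/
def LiftsCones (𝒮 : OperatorSystem V) (𝒯 : OperatorSystem W) (φ : V →ₗ[ℂ] W) : Prop :=
  ∀ p, ∀ Z ∈ 𝒯.cone p, ∃ Y ∈ 𝒮.cone p, Y.map φ = Z

lemma D_subset_C (𝒮 : OperatorSystem V) (J : Submodule ℂ V) (p : ℕ) : 𝒮.D J p ⊆ 𝒮.C J p := by
  rintro x ⟨H, hH, hx, K, hK, hKJ, hpos⟩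
  refine ⟨H, hH, hx, fun ε hε => ⟨K, hK, hKJ, ?_⟩⟩
  rw [add_assoc]
  exact 𝒮.cone_add (𝒮.cone_smul ε hε.le (𝒮.unit_mem p)) hpos

lemma map_mkQ_mem_D (J : Submodule ℂ V) {p : ℕ} {Y : Matrix (Fin p) (Fin p) V}
    (hY : Y ∈ 𝒮.cone p) : Y.map J.mkQ ∈ 𝒮.D J p :=
  ⟨Y, 𝒮.cone_adj hY, rfl, 0, by ext; simp [matAdj], fun _ _ => J.zero_mem, by rwa [add_zero]⟩

lemma IsCP.map_matAdj (h : 𝒮.IsCP 𝒯 φ) {p : ℕ} (X : Matrix (Fin p) (Fin p) V) :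
    (matAdj 𝒮.adj X).map φ = matAdj 𝒯.adj (X.map φ) := by
  ext i j
  exact h.map_adj (X j i)

lemma IsCP.exists_matAdj_eq_self_map_eq (h : 𝒮.IsCP 𝒯 φ) (hs : Function.Surjective φ) {p : ℕ}
    {Z : Matrix (Fin p) (Fin p) W} (hZ : matAdj 𝒯.adj Z = Z) :
    ∃ H, matAdj 𝒮.adj H = H ∧ H.map φ = Z := by
  obtain ⟨X, rfl⟩ : ∃ X : Matrix (Fin p) (Fin p) V, X.map φ = Z :=
    ⟨Z.map (Function.surjInv hs), by ext; simp [Function.surjInv_eq]⟩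
  refine ⟨((1 / 2 : ℝ) : ℂ) • (X + matAdj 𝒮.adj X), ?_, ?_⟩
  · rw [matAdj_smul, matAdj_add, matAdj_matAdj, add_comm]
  · rw [Matrix.map_smul _ _ (map_smul φ _), Matrix.map_add _ (map_add φ), h.map_matAdj, hZ]
    push_cast
    module

lemma LiftsCones.mem_D (hl : LiftsCones 𝒮 𝒯 φ) {p : ℕ}
    {x : Matrix (Fin p) (Fin p) (V ⧸ LinearMap.ker φ)}
    (hx : x.map ((LinearMap.ker φ).liftQ φ le_rfl) ∈ 𝒯.cone p) : x ∈ 𝒮.D (LinearMap.ker φ) p := by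
  obtain ⟨Y, hY, hYx⟩ := hl p _ hx
  have hinj : Function.Injective ((LinearMap.ker φ).liftQ φ le_rfl) := by
    rw [← LinearMap.ker_eq_bot]
    exact Submodule.ker_liftQ_eq_bot' _ _ rfl
  have hYx : Y.map (LinearMap.ker φ).mkQ = x :=
    Matrix.map_injective hinj hYx
  exact hYx ▸ map_mkQ_mem_D _ hY

variable {W : Type u} [AddCommGroup W] [Module ℂ W] {𝒯 : OperatorSystem W} {φ : V →ₗ[ℂ] W}

theorem IsCP.isCompletelyOrderProximinal_ker (h : 𝒮.IsCP 𝒯 φ) (hl : LiftsCones 𝒮 𝒯 φ) :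
    𝒮.IsCompletelyOrderProximinal (LinearMap.ker φ) :=
  ⟨h.isKernel, fun p => (D_subset_C 𝒮 _ p).antisymm fun _ hx => hl.mem_D (h.liftQ_mem hx)⟩

theorem IsCP.isCompleteQuotientMap (h : 𝒮.IsCP 𝒯 φ) (hs : Function.Surjective φ)
    (hl : LiftsCones 𝒮 𝒯 φ) : 𝒮.IsCompleteQuotientMap 𝒯 φ := by
  let e := φ.quotKerEquivOfSurjective hs
  have he : e.toLinearMap = (LinearMap.ker φ).liftQ φ le_rfl :=
    Submodule.linearMap_qext _ (LinearMap.ext fun _ => rfl)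
  refine ⟨h, e, he, fun p x hx => he ▸ h.liftQ_mem hx, fun p Z hZ => ?_⟩
  refine D_subset_C 𝒮 _ p (hl.mem_D ?_)
  rw [← he, Matrix.map_map, ← LinearMap.coe_comp]
  simpa using hZ

end Quotient

end OperatorSystem

namespace OpSys

section Duality

open Matrix
open scoped ComplexOrder Pointwise

variable {ι : Type*} [Fintype ι]

section

open scoped Matrix.Norms.L2Operator MatrixOrder

lemma posSemidef_iff_exists_eq_conjTranspose_mul_self {M : Matrix ι ι ℂ} :
    M.PosSemidef ↔ ∃ B : Matrix ι ι ℂ, M = Bᴴ * B := by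
  classical
  rw [← nonneg_iff_posSemidef]
  exact CStarAlgebra.nonneg_iff_eq_star_mul_self

lemma isClosed_posSemidef {κ : Type*} [Finite κ] : IsClosed {M : Matrix κ κ ℂ | M.PosSemidef} := by
  classical
  have := Fintype.ofFinite κ
  simp only [← nonneg_iff_posSemidef]
  exact CStarAlgebra.isClosed_nonneg

end

lemma exists_gram_eq_of_posSemidef {M : Matrix ι ι ℂ} (hM : M.PosSemidef) :
    ∃ y : ι → EuclideanSpace ℂ ι, gram ℂ y = M := by
  obtain ⟨B, rfl⟩ := posSemidef_iff_exists_eq_conjTranspose_mul_self.1 hM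
  refine ⟨fun i => WithLp.toLp 2 fun k => B k i, ?_⟩
  ext i j
  simp [PiLp.inner_apply, Matrix.mul_apply, mul_comm]

lemma norm_apply_le_re_trace_of_posSemidef {M : Matrix ι ι ℂ} (hM : M.PosSemidef) (i j : ι) :
    ‖M i j‖ ≤ M.trace.re := by
  obtain ⟨y, rfl⟩ := exists_gram_eq_of_posSemidef hM
  have htrace : (gram ℂ y).trace.re = ∑ k, ‖y k‖ ^ 2 := by
    simp [Matrix.trace, inner_self_eq_norm_sq_to_K, ← Complex.ofReal_pow]
  have hle (k : ι) : ‖y k‖ ^ 2 ≤ (gram ℂ y).trace.re := by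
    rw [htrace]
    exact Finset.single_le_sum (f := fun k => ‖y k‖ ^ 2) (fun _ _ => sq_nonneg _)
      (Finset.mem_univ k)
  calc ‖gram ℂ y i j‖ ≤ ‖y i‖ * ‖y j‖ := norm_inner_le_norm (𝕜 := ℂ) (y i) (y j)
    _ ≤ (gram ℂ y).trace.re := by nlinarith [hle i, hle j, sq_nonneg (‖y i‖ - ‖y j‖)]

lemma continuous_re_trace : Continuous fun X : Matrix ι ι ℂ => X.trace.re :=
  Complex.continuous_re.comp continuous_id.matrix_trace

lemma isCompact_posSemidef_re_trace_le (r : ℝ) :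
    IsCompact {M : Matrix ι ι ℂ | M.PosSemidef ∧ M.trace.re ≤ r} := by
  refine (isCompact_univ_pi fun _ => isCompact_univ_pi fun _ =>
    isCompact_closedBall (0 : ℂ) r).of_isClosed_subset
    (isClosed_posSemidef.inter (isClosed_le continuous_re_trace continuous_const)) ?_
  rintro M ⟨hM, hr⟩ i - j -
  simpa using (norm_apply_le_re_trace_of_posSemidef hM i j).trans hr

variable (𝒦 : Submodule ℂ (Matrix ι ι ℂ))

lemma isClosed_setOf_exists_add_posSemidef (htr : ∀ K ∈ 𝒦, K.trace = 0) :
    IsClosed {X : Matrix ι ι ℂ | ∃ K ∈ 𝒦, (X + K).PosSemidef} := by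
  refine isClosed_of_closure_subset fun X hX => ?_
  let U := {Y : Matrix ι ι ℂ | Y.trace.re < X.trace.re + 1}
  let P := {M : Matrix ι ι ℂ | M.PosSemidef ∧ M.trace.re ≤ X.trace.re + 1}
  have hU : IsOpen U := isOpen_lt continuous_re_trace continuous_const
  -- Adding elements of `𝒦` preserves the trace, so near `X` only a compact set of positive
  -- matrices matters.
  have hclosed : IsClosed (P + (𝒦 : Set (Matrix ι ι ℂ))) :=
    (Submodule.closed_of_finiteDimensional 𝒦).add_left_of_isCompact
      (isCompact_posSemidef_re_trace_le _)
  have hsub : U ∩ {Y | ∃ K ∈ 𝒦, (Y + K).PosSemidef} ⊆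
      P + (𝒦 : Set (Matrix ι ι ℂ)) := by
    rintro Y ⟨hY, K, hK, hYK⟩
    refine ⟨Y + K, ⟨hYK, ?_⟩, -K, 𝒦.neg_mem hK, add_neg_cancel_right Y K⟩
    rw [trace_add, htr K hK, add_zero]
    exact hY.le
  obtain ⟨M, hM, K, hK, rfl⟩ := closure_minimal hsub hclosed
    (hU.inter_closure ⟨lt_add_one X.trace.re, hX⟩)
  exact ⟨-K, 𝒦.neg_mem hK, by simpa using hM.1⟩

/-- For a space `𝒦` of trace zero matrices, the proper cone of those matrices whose class modulo
`𝒦` is the class of a positive semidefinite matrix. -/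
def posSemidefModCone (htr : ∀ K ∈ 𝒦, K.trace = 0) : ProperCone ℝ (Matrix ι ι ℂ) where
  carrier := {X | ∃ K ∈ 𝒦, (X + K).PosSemidef}
  add_mem' := by
    rintro X Y ⟨K, hK, hX⟩ ⟨L, hL, hY⟩
    exact ⟨K + L, 𝒦.add_mem hK hL, by rw [add_add_add_comm]; exact hX.add hY⟩
  zero_mem' := ⟨0, 𝒦.zero_mem, by simpa using PosSemidef.zero⟩
  smul_mem' := by
    rintro ⟨c, hc⟩ X ⟨K, hK, hX⟩
    refine ⟨(c : ℂ) • K, 𝒦.smul_mem _ hK, ?_⟩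
    have hcX := hX.smul (a := (c : ℂ)) (by exact_mod_cast hc)
    rw [smul_add] at hcX
    exact hcX
  isClosed' := isClosed_setOf_exists_add_posSemidef 𝒦 htr

lemma exists_re_trace_mul_eq (f : Matrix ι ι ℂ →ₗ[ℝ] ℝ) :
    ∃ G : Matrix ι ι ℂ, ∀ X, (G * X).trace.re = f X := by
  classical
  refine ⟨of fun j i => f (single i j 1) - f (single i j Complex.I) * Complex.I, fun X => ?_⟩
  have hsingle (i j : ι) (z : ℂ) : f (single i j z) =
      z.re * f (single i j 1) + z.im * f (single i j Complex.I) := by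
    have hz : single i j z = z.re • single i j (1 : ℂ) + z.im • single i j Complex.I := by
      rw [smul_single, smul_single, ← single_add]
      simp [Complex.re_add_im]
    rw [hz, map_add, map_smul, map_smul, smul_eq_mul, smul_eq_mul]
  conv_rhs => rw [matrix_eq_sum_single X]
  simp only [map_sum, Matrix.trace, diag_apply, Matrix.mul_apply, Complex.re_sum]
  rw [Finset.sum_comm]
  refine Finset.sum_congr rfl fun i _ => Finset.sum_congr rfl fun j _ => ?_
  rw [hsingle]
  simp only [of_apply, Complex.mul_re, Complex.sub_re, Complex.sub_im, Complex.ofReal_re,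
    Complex.ofReal_im, Complex.mul_im, Complex.I_re, Complex.I_im]
  ring

lemma exists_isHermitian_re_trace_mul_eq (f : Matrix ι ι ℂ →ₗ[ℝ] ℝ) :
    ∃ G : Matrix ι ι ℂ, G.IsHermitian ∧
      ∀ X, (G * X).trace.re = f ((1 / 2 : ℝ) • (X + Xᴴ)) := by
  obtain ⟨G, hG⟩ := exists_re_trace_mul_eq f
  refine ⟨(1 / 2 : ℝ) • (G + Gᴴ), ?_, fun X => ?_⟩
  · simp [IsHermitian, add_comm]
  · have hstar : (Gᴴ * X).trace.re = (G * Xᴴ).trace.re := by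
      rw [trace_mul_comm G, ← conjTranspose_conjTranspose X, ← conjTranspose_mul,
        trace_conjTranspose, conjTranspose_conjTranspose]
      simp
    rw [map_smul, map_add, ← hG, ← hG, ← hstar]
    simp [add_mul, mul_add]

theorem exists_mem_add_posSemidef (htr : ∀ K ∈ 𝒦, K.trace = 0) (hstar : ∀ K ∈ 𝒦, Kᴴ ∈ 𝒦)
    {H : Matrix ι ι ℂ} (hH : H.IsHermitian)
    (hdual : ∀ G : Matrix ι ι ℂ, G.PosSemidef → (∀ K ∈ 𝒦, (G * K).trace = 0) →
      0 ≤ (G * H).trace.re) :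
    ∃ K ∈ 𝒦, (H + K).PosSemidef := by
  by_contra hH_notMem
  have : LocallyConvexSpace ℝ (Matrix ι ι ℂ) := inferInstanceAs (LocallyConvexSpace ℝ (ι → ι → ℂ))
  obtain ⟨f, hf_nonneg, hf_neg⟩ :=
    (posSemidefModCone 𝒦 htr).hyperplane_separation_point (x₀ := H) hH_notMem
  obtain ⟨G, hG, hGf⟩ := exists_isHermitian_re_trace_mul_eq f.toLinearMap
  have hGf_herm {X : Matrix ι ι ℂ} (hX : X.IsHermitian) : (G * X).trace.re = f X := by
    rw [hGf, hX.eq, ← two_smul ℝ X, smul_smul]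
    norm_num
  have hf_zero (K) (hK : K ∈ 𝒦) : f K = 0 := by
    refine le_antisymm ?_ (hf_nonneg K ⟨-K, 𝒦.neg_mem hK, by simpa using PosSemidef.zero⟩)
    simpa using hf_nonneg (-K) ⟨K, hK, by simpa using PosSemidef.zero⟩
  have hGre (K) (hK : K ∈ 𝒦) : (G * K).trace.re = 0 := by
    rw [hGf]
    exact hf_zero _ ((𝒦.restrictScalars ℝ).smul_mem _ (𝒦.add_mem hK (hstar K hK)))
  have hGK (K) (hK : K ∈ 𝒦) : (G * K).trace = 0 :=
    Complex.ext (hGre K hK) (by simpa using hGre _ (𝒦.smul_mem Complex.I hK))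
  have hG_pos : G.PosSemidef := by
    refine .of_dotProduct_mulVec_nonneg hG fun v => Complex.nonneg_iff.2
      ⟨?_, (hG.im_star_dotProduct_mulVec_self v).symm⟩
    have hv := posSemidef_vecMulVec_self_star v
    calc 0 ≤ f (vecMulVec v (star v)) := hf_nonneg _ ⟨0, 𝒦.zero_mem, by simpa using hv⟩
      _ = (star v ⬝ᵥ G *ᵥ v).re := by
        rw [← hGf_herm hv.isHermitian, mul_vecMulVec, trace_vecMulVec, dotProduct_comm]
  have := hdual G hG_pos hGK
  rw [hGf_herm hH] at this
  linarith

end Duality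

end OpSys

namespace OpSys

section Gram

variable {𝕜 ι E F : Type*} [RCLike 𝕜] [NormedAddCommGroup E] [InnerProductSpace 𝕜 E]
  [NormedAddCommGroup F] [InnerProductSpace 𝕜 F]

lemma norm_sum_smul_eq_of_gram_eq {x : ι → E} {y : ι → F} (h : Matrix.gram 𝕜 x = Matrix.gram 𝕜 y)
    (s : Finset ι) (c : ι → 𝕜) : ‖∑ a ∈ s, c a • x a‖ = ‖∑ a ∈ s, c a • y a‖ := by
  have hinner (a b : ι) : inner 𝕜 (x a) (x b) = inner 𝕜 (y a) (y b) := congrFun₂ h a b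
  rw [norm_eq_sqrt_re_inner (𝕜 := 𝕜), norm_eq_sqrt_re_inner (𝕜 := 𝕜)]
  simp only [sum_inner, inner_sum, inner_smul_left, inner_smul_right, hinner]

lemma exists_linearIsometryEquiv_of_gram_eq [FiniteDimensional 𝕜 F] {x y : ι → F}
    (h : Matrix.gram 𝕜 x = Matrix.gram 𝕜 y) : ∃ U : F ≃ₗᵢ[𝕜] F, ∀ a, U (x a) = y a := by
  let Lx := Finsupp.linearCombination 𝕜 x
  let Ly := Finsupp.linearCombination 𝕜 y
  have hnorm (c : ι →₀ 𝕜) : ‖Lx c‖ = ‖Ly c‖ := norm_sum_smul_eq_of_gram_eq h c.support c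
  have hker : LinearMap.ker Lx ≤ LinearMap.ker Ly := fun c hc => by
    rwa [LinearMap.mem_ker, ← norm_eq_zero, ← hnorm, norm_eq_zero]
  let L : LinearMap.range Lx →ₗ[𝕜] F :=
    (LinearMap.ker Lx).liftQ Ly hker ∘ₗ Lx.quotKerEquivRange.symm.toLinearMap
  have hL (c : ι →₀ 𝕜) : L ⟨Lx c, c, rfl⟩ = Ly c := by
    have hsymm : Lx.quotKerEquivRange.symm ⟨Lx c, c, rfl⟩ = (LinearMap.ker Lx).mkQ c := by
      rw [LinearEquiv.symm_apply_eq]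
      rfl
    simp [L, hsymm]
  let U : LinearMap.range Lx →ₗᵢ[𝕜] F :=
    { L with
      norm_map' := by
        rintro ⟨_, c, rfl⟩
        exact (congrArg norm (hL c)).trans (hnorm c).symm }
  refine ⟨U.extend.toLinearIsometryEquiv rfl, fun a => ?_⟩
  have hx : Lx (Finsupp.single a 1) = x a := by simp [Lx]
  have hy : Ly (Finsupp.single a 1) = y a := by simp [Ly]
  rw [LinearIsometry.coe_toLinearIsometryEquiv, ← hx, ← hy, ← hL]
  exact U.extend_apply ⟨Lx (Finsupp.single a 1), _, rfl⟩

end Gram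

end OpSys

namespace OperatorSystem

section IsPosMat

open Matrix
open scoped ComplexOrder

variable {A B : Type*} [CStarAlgebra A] [CStarAlgebra B] {κ : Type*} [Fintype κ] {p : ℕ}

lemma IsPosMat.map {X : Matrix (Fin p) (Fin p) A} (hX : IsPosMat X) (π : A →⋆ₐ[ℂ] B) :
    IsPosMat (X.map π) := by
  obtain ⟨Y, rfl⟩ := hX
  refine ⟨Y.map π, ?_⟩
  ext a b
  simp only [map_apply, Matrix.mul_apply, conjTranspose_apply, map_sum, map_mul, map_star]

lemma isPosMat_conjTranspose_mul_self (Z : Matrix κ (Fin p) A) : IsPosMat (Zᴴ * Z) := by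
  let _ := CStarAlgebra.spectralOrder A
  let _ := CStarAlgebra.spectralOrderedRing A
  convert isPosMat_rect (Z.submatrix (Fintype.equivFin κ).symm id) using 1
  ext a b
  simp only [Matrix.mul_apply, conjTranspose_apply, submatrix_apply, id]
  exact ((Fintype.equivFin κ).symm.sum_comp fun k => star (Z k a) * Z k b).symm

lemma isPosMat_sum_smul_star_mul {M : Matrix (Fin p × κ) (Fin p × κ) ℂ} (hM : M.PosSemidef)
    (w : κ → A) :
    IsPosMat (of fun a b => ∑ k, ∑ l, M (a, k) (b, l) • (star (w k) * w l)) := by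
  obtain ⟨R, rfl⟩ := posSemidef_iff_exists_eq_conjTranspose_mul_self.1 hM
  convert isPosMat_conjTranspose_mul_self (of fun m b => ∑ l, R m (b, l) • w l) using 1
  ext a b
  simp only [of_apply, Matrix.mul_apply, conjTranspose_apply, star_sum, star_smul,
    Finset.sum_mul_sum, smul_mul_smul_comm, Finset.sum_smul]
  symm
  rw [Finset.sum_comm]
  exact Finset.sum_congr rfl fun k _ => Finset.sum_comm

lemma IsPosMat.re_sum_inner_nonneg {F : Type*} [NormedAddCommGroup F] [InnerProductSpace ℂ F]
    [CompleteSpace F] {X : Matrix (Fin p) (Fin p) (F →L[ℂ] F)} (hX : IsPosMat X) (x : Fin p → F) :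
    0 ≤ (∑ a, ∑ b, inner ℂ (x a) (X a b (x b))).re := by
  obtain ⟨Y, rfl⟩ := hX
  have hsum : ∑ a, ∑ b, inner ℂ (x a) ((Yᴴ * Y) a b (x b)) =
      ∑ c, inner ℂ (∑ a, Y c a (x a)) (∑ b, Y c b (x b)) := by
    simp only [sum_inner, inner_sum, Matrix.mul_apply, conjTranspose_apply, _root_.sum_apply,
      mul_apply_eq_comp, ContinuousLinearMap.star_eq_adjoint,
      ContinuousLinearMap.adjoint_inner_right]
    rw [Finset.sum_comm]
    conv_rhs => rw [Finset.sum_comm]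
    exact Finset.sum_congr rfl fun b _ => Finset.sum_comm
  rw [hsum, Complex.re_sum]
  exact Finset.sum_nonneg fun c _ => inner_self_nonneg (𝕜 := ℂ)

open scoped Matrix.Norms.L2Operator in
lemma isPosMat_iff_posSemidef_comp {μ : Type*} [Fintype μ] [DecidableEq μ]
    {X : Matrix (Fin p) (Fin p) (Matrix μ μ ℂ)} :
    IsPosMat X ↔ (comp _ _ _ _ ℂ X).PosSemidef := by
  rw [posSemidef_iff_exists_eq_conjTranspose_mul_self]
  have hcomp (Y : Matrix (Fin p) (Fin p) (Matrix μ μ ℂ)) :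
      comp _ _ _ _ ℂ (Yᴴ * Y) = (comp _ _ _ _ ℂ Y)ᴴ * comp _ _ _ _ ℂ Y := by
    ext ⟨a, i⟩ ⟨b, j⟩
    simp only [comp_apply, Matrix.mul_apply, Matrix.sum_apply, conjTranspose_apply, star_apply,
      Fintype.sum_prod_type]
  constructor
  · rintro ⟨Y, rfl⟩
    exact ⟨_, hcomp Y⟩
  · rintro ⟨Z, hZ⟩
    refine ⟨(comp _ _ _ _ ℂ).symm Z, (comp _ _ _ _ ℂ).injective ?_⟩
    rw [hcomp, Equiv.apply_symm_apply, hZ]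

end IsPosMat

end OperatorSystem

namespace Tridiag

open OpSys OperatorSystem Matrix
open scoped Matrix.Norms.L2Operator ComplexOrder

variable {n p : ℕ}

section Coboundary

variable {G : Type*} [Group G]

/-- The differences `W_j⁻¹ W_{j+1}` of a sequence in a group. Along such a sequence of unitaries the
band matrix is the tridiagonal part of the positive matrix `[W_k^* W_l]`. -/
def coboundary (W : Fin n → G) (j : Fin (n - 1)) : G :=
  (W ⟨j, by omega⟩)⁻¹ * W ⟨j + 1, by omega⟩

lemma exists_coboundary_eq (u : Fin (n - 1) → G) : ∃ W : Fin n → G, coboundary W = u := by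
  cases n with
  | zero => exact ⟨Fin.elim0, funext fun j => j.elim0⟩
  | succ n => exact ⟨Fin.partialProd u, funext (Fin.partialProd_right_inv u)⟩

end Coboundary

section Phi

variable {A B : Type} [CStarAlgebra A] [CStarAlgebra B]

lemma coe_phi (u : Fin (n - 1) → A) (X : T n) :
    (phi u X : A) = (1 / (n : ℂ)) • ∑ k, ∑ l, X.1 k l • band u k l := by
  simp only [phi, LinearMap.coe_mk, AddHom.coe_mk, AddSubmonoidClass.coe_finsetSum,
    Submodule.coe_smul, Finset.smul_sum, smul_smul, mul_comm]

lemma band_self (u : Fin (n - 1) → A) (k : Fin n) : band u k k = 1 := by simp [band]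

lemma band_succ (u : Fin (n - 1) → A) (j : Fin (n - 1)) :
    band u ⟨j, by omega⟩ ⟨j + 1, by omega⟩ = u j := by
  simp [band]

lemma band_pred (u : Fin (n - 1) → A) (j : Fin (n - 1)) :
    band u ⟨j + 1, by omega⟩ ⟨j, by omega⟩ = star (u j) := by
  simp [band, add_assoc]

lemma map_band (π : A →⋆ₐ[ℂ] B) (u : Fin (n - 1) → A) (k l : Fin n) :
    π (band u k l) = band (fun j => π (u j)) k l := by
  unfold band
  split_ifs
  · exact map_one π
  · rfl
  · exact map_star π _
  · exact map_zero π

lemma map_coe_phi (π : A →⋆ₐ[ℂ] B) (u : Fin (n - 1) → A) (X : T n) :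
    π (phi u X) = phi (fun j => π (u j)) X := by
  simp only [coe_phi, map_smul, map_sum, map_band]

lemma band_coboundary (W : Fin n → unitary A) {k l : Fin n} (hkl : ¬ 2 ≤ |(k : ℤ) - (l : ℤ)|) :
    band (fun j => (↑(coboundary W j) : A)) k l = star (W k : A) * W l := by
  unfold band
  split_ifs with heq hsucc hpred
  · simp [heq]
  · simp [coboundary, hsucc, ← Unitary.star_eq_inv]
  · simp [coboundary, hpred, ← Unitary.star_eq_inv]
  · have := Fin.val_ne_of_ne heq
    rw [le_abs] at hkl
    omega

lemma coe_phi_coboundary (W : Fin n → unitary A) (X : T n) :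
    (phi (fun j => (↑(coboundary W j) : A)) X : A) =
      (1 / (n : ℂ)) • ∑ k, ∑ l, X.1 k l • (star (W k : A) * W l) := by
  rw [coe_phi]
  congr 1
  refine Finset.sum_congr rfl fun k _ => Finset.sum_congr rfl fun l _ => ?_
  by_cases hkl : 2 ≤ |(k : ℤ) - (l : ℤ)|
  · rw [X.2 k l hkl, zero_smul, zero_smul]
  · rw [band_coboundary W hkl]

lemma phi_surjective [NeZero n] (u : Fin (n - 1) → A) : Function.Surjective (phi u) := by
  suffices hle : S u ≤ (LinearMap.range (phi u)).map (S u).subtype by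
    intro y
    obtain ⟨_, ⟨X, rfl⟩, hX⟩ := hle y.2
    exact ⟨X, Subtype.ext hX⟩
  have hband (i j : Fin n) (h : |(i : ℤ) - (j : ℤ)| ≤ 1) :
      band u i j ∈ (LinearMap.range (phi u)).map (S u).subtype := by
    refine ⟨(n : ℂ) • phi u ⟨single i j 1, single_mem_T i j h⟩,
      Submodule.smul_mem _ _ ⟨_, rfl⟩, ?_⟩
    rw [map_smul, Submodule.subtype_apply, phi_single u i j h, smul_smul,
      mul_one_div_cancel (NeZero.ne _), one_smul]
  refine Submodule.span_le.2 ?_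
  rintro x ((rfl | ⟨j, rfl⟩) | ⟨j, rfl⟩)
  · exact band_self u 0 ▸ hband 0 0 (by simp)
  · exact band_succ u j ▸ hband ⟨j, by omega⟩ ⟨j + 1, by omega⟩ (by simp)
  · exact (band_pred u j).subst (hband ⟨j + 1, by omega⟩ ⟨j, by omega⟩ (by simp))

end Phi

section Flatten

/-- A matrix over `T_n` as a scalar matrix, forgetting the block structure. -/
def flatten (X : Matrix (Fin p) (Fin p) (T n)) : Matrix (Fin p × Fin n) (Fin p × Fin n) ℂ :=
  comp _ _ _ _ ℂ (X.map (T n).subtype)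

lemma mem_cone_TSys_iff {X : Matrix (Fin p) (Fin p) (T n)} :
    X ∈ (TSys n).cone p ↔ (flatten X).PosSemidef :=
  isPosMat_iff_posSemidef_comp

lemma isHermitian_flatten {X : Matrix (Fin p) (Fin p) (T n)}
    (hX : matAdj (TSys n).adj X = X) : (flatten X).IsHermitian := by
  ext ⟨a, k⟩ ⟨b, l⟩
  exact congrFun₂ (congrArg Subtype.val (congrFun₂ hX a b)) k l

end Flatten

section BlockJ

/-- The matrices over `J_n`, as a space of scalar matrices as in `flatten`. -/
def blockJ (n p : ℕ) : Submodule ℂ (Matrix (Fin p × Fin n) (Fin p × Fin n) ℂ) where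
  carrier := {K | ∀ a b, (comp _ _ _ _ ℂ).symm K a b ∈ J n}
  zero_mem' _ _ := (J n).zero_mem
  add_mem' hK hL a b := (J n).add_mem (hK a b) (hL a b)
  smul_mem' c _ hK a b := (J n).smul_mem c (hK a b)

lemma J_le_T (n : ℕ) : J n ≤ T n := fun _ hA i j h => hA.1 (by rintro rfl; simp at h)

lemma J_le_ker_phi {A : Type} [CStarAlgebra A] (u : Fin (n - 1) → A) :
    (J n).submoduleOf (T n) ≤ LinearMap.ker (phi u) := by
  rintro ⟨X, hXT⟩ hX
  obtain ⟨hdiag, htrace⟩ : X ∈ J n := hX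
  have hrow (k : Fin n) : ∑ l, X k l • band u k l = X k k • (1 : A) := by
    rw [Finset.sum_eq_single k]
    · rw [band_self]
    · intro l _ hl
      rw [hdiag hl.symm, zero_smul]
    · simp
  rw [LinearMap.mem_ker, Subtype.ext_iff, coe_phi]
  simp only [hrow, ← Finset.sum_smul]
  rw [show ∑ k, X k k = 0 from htrace, zero_smul, smul_zero, Submodule.coe_zero]

lemma trace_eq_zero_of_mem_blockJ {K : Matrix (Fin p × Fin n) (Fin p × Fin n) ℂ}
    (hK : K ∈ blockJ n p) : K.trace = 0 := by
  rw [Matrix.trace, Fintype.sum_prod_type]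
  exact Finset.sum_eq_zero fun a _ => (hK a a).2

lemma conjTranspose_mem_blockJ {K : Matrix (Fin p × Fin n) (Fin p × Fin n) ℂ}
    (hK : K ∈ blockJ n p) : Kᴴ ∈ blockJ n p := fun a b =>
  ⟨(hK b a).1.conjTranspose, by
    have h := trace_conjTranspose ((comp _ _ _ _ ℂ).symm K b a)
    rwa [(hK b a).2, star_zero] at h⟩

lemma single_sub_single_mem_J (k l : Fin n) : single k k (1 : ℂ) - single l l 1 ∈ J n := by
  refine ⟨?_, by simp [trace_single_eq_same]⟩
  rw [← diagonal_single, ← diagonal_single, diagonal_sub]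
  exact isDiag_diagonal _

lemma apply_eq_apply_of_trace_mul_eq_zero {G : Matrix (Fin p × Fin n) (Fin p × Fin n) ℂ}
    (hG : ∀ K ∈ blockJ n p, (G * K).trace = 0) (a b : Fin p) (k l : Fin n) :
    G (a, k) (b, k) = G (a, l) (b, l) := by
  have hmem : single (b, k) (a, k) (1 : ℂ) - single (b, l) (a, l) 1 ∈ blockJ n p := by
    intro c d
    have hblock :
        (comp _ _ _ _ ℂ).symm (single (b, k) (a, k) (1 : ℂ) - single (b, l) (a, l) 1) c d =
          single b a (1 : ℂ) c d • (single k k 1 - single l l 1) := by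
      ext i j
      simp only [comp_symm_apply, Matrix.sub_apply, Matrix.smul_apply, single_apply, Prod.mk.injEq,
        smul_eq_mul]
      grind
    exact hblock ▸ (J n).smul_mem _ (single_sub_single_mem_J k l)
  have h := hG _ hmem
  rw [mul_sub, trace_sub, sub_eq_zero] at h
  simpa [trace_mul_single] using h

end BlockJ

section Positivity

variable {A : Type} [CStarAlgebra A] {u : Fin (n - 1) → A}

theorem isCP_phi (hu : ∀ j, u j ∈ unitary A) : (TSys n).IsCP (SSys u) (phi u) := by
  intro p X hX
  lift u to Fin (n - 1) → unitary A using hu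
  obtain ⟨W, rfl⟩ := exists_coboundary_eq u
  have hflat : ((1 / (n : ℂ)) • flatten X).PosSemidef :=
    (mem_cone_TSys_iff.1 hX).smul (by positivity)
  change IsPosMat _
  convert isPosMat_sum_smul_star_mul hflat (fun k => (W k : A)) using 1
  ext a b
  refine (coe_phi_coboundary W (X a b)).trans ?_
  simp only [Finset.smul_sum, smul_smul]
  rfl

/-- The finite dimensional case of the universal property in `IsUniversalUnitaries`: every family of
unitary operators on a finite dimensional Hilbert space is the image of `u` under a
representation. -/
def HasFiniteDimensionalRepresentations {ι : Type*} (u : ι → A) : Prop :=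
  ∀ (F : Type) [NormedAddCommGroup F] [InnerProductSpace ℂ F] [CompleteSpace F]
    [FiniteDimensional ℂ F] (v : ι → unitary (F →L[ℂ] F)),
    ∃ π : A →⋆ₐ[ℂ] (F →L[ℂ] F), ∀ i, π (u i) = v i

lemma hasFiniteDimensionalRepresentations_of_isUniversalUnitaries {ι : Type*} {u : ι → A}
    (hu : IsUniversalUnitaries u) : HasFiniteDimensionalRepresentations u := fun F _ _ _ _ v =>
  hu.universal (F →L[ℂ] F) (fun i => v i) fun i => (v i).2

variable {F : Type} [NormedAddCommGroup F] [InnerProductSpace ℂ F] [CompleteSpace F]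

lemma exists_unitary_apply_eq [NeZero n] [FiniteDimensional ℂ F] {y : Fin p × Fin n → F}
    (hann : ∀ K ∈ blockJ n p, ((gram ℂ y)ᵀ * K).trace = 0) :
    ∃ W : Fin n → unitary (F →L[ℂ] F), ∀ a k, (W k : F →L[ℂ] F) (y (a, 0)) = y (a, k) := by
  have hgram (k : Fin n) : gram ℂ (fun a => y (a, 0)) = gram ℂ (fun a => y (a, k)) := by
    ext a b
    exact apply_eq_apply_of_trace_mul_eq_zero hann b a 0 k
  choose U hU using fun k => exists_linearIsometryEquiv_of_gram_eq (hgram k)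
  exact ⟨fun k => Unitary.linearIsometryEquiv.symm (U k), fun a k => hU k a⟩

lemma inner_phi_coboundary (W : Fin n → unitary (F →L[ℂ] F)) (X : T n) (x y : F) :
    inner ℂ x ((phi (fun j => (↑(coboundary W j) : F →L[ℂ] F)) X : F →L[ℂ] F) y) =
      (1 / (n : ℂ)) * ∑ k, ∑ l, X.1 k l * inner ℂ ((W k : F →L[ℂ] F) x) ((W l : F →L[ℂ] F) y) := by
  simp only [coe_phi_coboundary, _root_.smul_apply, _root_.sum_apply, inner_smul_right, inner_sum,
    mul_apply_eq_comp, ContinuousLinearMap.star_eq_adjoint, ContinuousLinearMap.adjoint_inner_right]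

lemma trace_transpose_gram_mul_flatten [NeZero n] (W : Fin n → unitary (F →L[ℂ] F))
    (x : Fin p → F) (X : Matrix (Fin p) (Fin p) (T n)) :
    ((gram ℂ fun i : Fin p × Fin n => (W i.2 : F →L[ℂ] F) (x i.1))ᵀ * flatten X).trace =
      n * ∑ a, ∑ b, inner ℂ (x a)
        ((phi (fun j => (↑(coboundary W j) : F →L[ℂ] F)) (X a b) : F →L[ℂ] F) (x b)) := by
  simp only [inner_phi_coboundary, ← Finset.mul_sum]
  rw [← mul_assoc, mul_one_div_cancel (NeZero.ne _), one_mul, trace_mul_comm]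
  simp only [Matrix.trace, diag_apply, Matrix.mul_apply, Fintype.sum_prod_type]
  exact Finset.sum_congr rfl fun a _ => Finset.sum_comm

lemma re_sum_inner_phi_nonneg {X : Matrix (Fin p) (Fin p) (T n)}
    (hX : X.map (phi u) ∈ (SSys u).cone p) {π : A →⋆ₐ[ℂ] (F →L[ℂ] F)}
    {v : Fin (n - 1) → F →L[ℂ] F} (hπ : ∀ j, π (u j) = v j) (x : Fin p → F) :
    0 ≤ (∑ a, ∑ b, inner ℂ (x a) ((phi v (X a b) : F →L[ℂ] F) (x b))).re := by
  obtain rfl : (fun j => π (u j)) = v := funext hπ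
  have hpos : IsPosMat ((X.map (phi u)).map (S u).subtype) := hX
  have hinner := (hpos.map π).re_sum_inner_nonneg x
  simp only [map_apply, Submodule.subtype_apply, map_coe_phi] at hinner
  exact hinner

lemma re_trace_mul_flatten_nonneg [NeZero n] (hrep : HasFiniteDimensionalRepresentations u)
    {X : Matrix (Fin p) (Fin p) (T n)} (hX : X.map (phi u) ∈ (SSys u).cone p)
    {G : Matrix (Fin p × Fin n) (Fin p × Fin n) ℂ} (hG : G.PosSemidef)
    (hann : ∀ K ∈ blockJ n p, (G * K).trace = 0) : 0 ≤ (G * flatten X).trace.re := by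
  obtain ⟨y, hy⟩ := exists_gram_eq_of_posSemidef hG.transpose
  obtain rfl : (gram ℂ y)ᵀ = G := by rw [hy, transpose_transpose]
  obtain ⟨W, hW⟩ := exists_unitary_apply_eq hann
  obtain ⟨π, hπ⟩ := hrep _ (coboundary W)
  have htrace := trace_transpose_gram_mul_flatten W (fun a => y (a, 0)) X
  simp only [hW, Prod.mk.eta] at htrace
  rw [htrace, ← Complex.ofReal_natCast, Complex.re_ofReal_mul]
  exact mul_nonneg n.cast_nonneg (re_sum_inner_phi_nonneg hX hπ _)

theorem exists_add_mem_cone [NeZero n] (hrep : HasFiniteDimensionalRepresentations u)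
    {X : Matrix (Fin p) (Fin p) (T n)} (hX : matAdj (TSys n).adj X = X)
    (hpos : X.map (phi u) ∈ (SSys u).cone p) :
    ∃ K : Matrix (Fin p) (Fin p) (T n), (∀ a b, K a b ∈ (J n).submoduleOf (T n)) ∧
      X + K ∈ (TSys n).cone p := by
  obtain ⟨K, hK, hXK⟩ := exists_mem_add_posSemidef (blockJ n p)
    (fun K => trace_eq_zero_of_mem_blockJ) (fun K => conjTranspose_mem_blockJ)
    (isHermitian_flatten hX) fun G => re_trace_mul_flatten_nonneg hrep hpos
  exact ⟨of fun a b => ⟨_, J_le_T n (hK a b)⟩, hK, mem_cone_TSys_iff.2 hXK⟩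

theorem liftsCones_phi [NeZero n] (hu : ∀ j, u j ∈ unitary A)
    (hrep : HasFiniteDimensionalRepresentations u) : LiftsCones (TSys n) (SSys u) (phi u) := by
  intro p Z hZ
  obtain ⟨X, hX, rfl⟩ :=
    (isCP_phi hu).exists_matAdj_eq_self_map_eq (phi_surjective u) ((SSys u).cone_adj hZ)
  obtain ⟨K, hK, hXK⟩ := exists_add_mem_cone hrep hX hZ
  refine ⟨X + K, hXK, ?_⟩
  ext a b : 1
  rw [map_apply, Matrix.add_apply, map_add, J_le_ker_phi u (hK a b), add_zero, map_apply]

lemma eq_zero_of_mem_cone {K : Matrix (Fin p) (Fin p) (T n)}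
    (hpos : K ∈ (TSys n).cone p) (htrace : ∀ a, (K a a).1.trace = 0) : K = 0 := by
  rw [mem_cone_TSys_iff] at hpos
  have hflat : (flatten K).trace = 0 := by
    rw [Matrix.trace, Fintype.sum_prod_type]
    exact Finset.sum_eq_zero fun a _ => htrace a
  ext a b k l
  have hle := norm_apply_le_re_trace_of_posSemidef hpos (a, k) (b, l)
  rw [hflat, Complex.zero_re, norm_le_zero_iff] at hle
  exact hle

theorem ker_phi [NeZero n] (hu : ∀ j, u j ∈ unitary A)
    (hrep : HasFiniteDimensionalRepresentations u) :
    LinearMap.ker (phi u) = (J n).submoduleOf (T n) := by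
  refine le_antisymm (fun X hX => ?_) (J_le_ker_phi u)
  have hadj : phi u ((TSys n).adj X) = 0 := by rw [(isCP_phi hu).map_adj, hX, map_zero]
  let Y : Matrix (Fin 2) (Fin 2) (T n) := !![0, X; (TSys n).adj X, 0]
  have hY : matAdj (TSys n).adj Y = Y := by
    ext a b : 1
    fin_cases a <;> fin_cases b <;> simp [Y, matAdj, (TSys n).adj_adj]
  have hYphi : Y.map (phi u) = 0 := by
    ext a b : 1
    fin_cases a <;> fin_cases b <;> simp [Y, hadj, LinearMap.mem_ker.1 hX]
  obtain ⟨K, hK, hpos⟩ := exists_add_mem_cone hrep hY (hYphi ▸ ⟨0, by ext; simp⟩)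
  have hzero : Y + K = 0 := eq_zero_of_mem_cone hpos fun a => by
    have : (Y + K) a a = K a a := by fin_cases a <;> simp [Y]
    rw [this]
    exact (hK a a).2
  have hXK : X + K 0 1 = 0 := congrFun₂ hzero 0 1
  rw [eq_neg_of_add_eq_zero_left hXK]
  exact neg_mem (hK 0 1)

end Positivity

end Tridiag

end

theorem mainTheorem12_general {A : Type} [CStarAlgebra A] {n : ℕ} [NeZero n] {u : Fin (n - 1) → A}
    (hu : ∀ j, u j ∈ unitary A) (hrep : Tridiag.HasFiniteDimensionalRepresentations u) :
    Tridiag.J n ≤ Tridiag.T n ∧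
    LinearMap.ker (Tridiag.phi u) = (Tridiag.J n).submoduleOf (Tridiag.T n) ∧
    (Tridiag.TSys n).IsCompletelyOrderProximinal ((Tridiag.J n).submoduleOf (Tridiag.T n)) ∧
    (Tridiag.TSys n).IsCompleteQuotientMap (Tridiag.SSys u) (Tridiag.phi u) ∧
    ∃ (hJ : (Tridiag.TSys n).IsKernel ((Tridiag.J n).submoduleOf (Tridiag.T n)))
      (e : (Tridiag.T n ⧸ (Tridiag.J n).submoduleOf (Tridiag.T n)) →ₗ[ℂ] Tridiag.S u),
      ((Tridiag.TSys n).quotient _ hJ).IsCompleteOrderIso (Tridiag.SSys u) e ∧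
      ∀ X : Tridiag.T n, e (Submodule.Quotient.mk X) = Tridiag.phi u X := by
  have hker := Tridiag.ker_phi hu hrep
  have hcp := Tridiag.isCP_phi hu
  have hlift := Tridiag.liftsCones_phi hu hrep
  have hquot := hcp.isCompleteQuotientMap (Tridiag.phi_surjective u) hlift
  refine ⟨Tridiag.J_le_T n, hker, ?_, hquot, ?_⟩
  all_goals rw [← hker]
  · exact hcp.isCompletelyOrderProximinal_ker hlift
  · exact ⟨hcp.isKernel, _, hquot.2, fun X => rfl⟩

theorem mainTheorem12 (n : ℕ) (hn : 2 ≤ n)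
    (u : Fin (n - 1) → FullGroupCStar (FreeGroup (Fin (n - 1))))
    (hu : IsUniversalUnitaries u) :
    Tridiag.J n ≤ Tridiag.T n ∧
    LinearMap.ker (Tridiag.phi u) = (Tridiag.J n).submoduleOf (Tridiag.T n) ∧
    (Tridiag.TSys n).IsCompletelyOrderProximinal ((Tridiag.J n).submoduleOf (Tridiag.T n)) ∧
    (Tridiag.TSys n).IsCompleteQuotientMap (Tridiag.SSys u) (Tridiag.phi u) ∧
    ∃ (hJ : (Tridiag.TSys n).IsKernel ((Tridiag.J n).submoduleOf (Tridiag.T n)))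
      (e : (Tridiag.T n ⧸ (Tridiag.J n).submoduleOf (Tridiag.T n)) →ₗ[ℂ] Tridiag.S u),
      ((Tridiag.TSys n).quotient _ hJ).IsCompleteOrderIso (Tridiag.SSys u) e ∧
      ∀ X : Tridiag.T n, e (Submodule.Quotient.mk X) = Tridiag.phi u X := by
  have : NeZero n := ⟨by omega⟩
  exact mainTheorem12_general hu.unitary
    (Tridiag.hasFiniteDimensionalRepresentations_of_isUniversalUnitaries hu)
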